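/- Let $G$ be a countable discrete group. Work with approximate semantics (Henson–Iovino) in the two-sorted language $L_G$ of complex Hilbert spaces expanded by unary functions $\tau_g$ ($g\in G$): the sorts are the space and the complex field, and the terms are built from variables of both sorts, the vector $0$, constants for the rational numbers and for $i$, addition, scalar multiplication, multiplication and conjugation of scalars, the inner product $\langle\cdot,\cdot\rangle$, the norm and the $\tau_g$. An $L_G$-structure is a complex Banach space with functions $\langle\cdot,\cdot\rangle$ and $\tau_g$ that are uniformly continuous on bounded sets; the scalar sort is always interpreted as $\mathbb C$. Positive bounded formulas are built from atomic formulas $\operatorname{Re} t\le p$ and $\operatorname{Re} t\ge p$ ($t$ a scalar term, $p\in\mathbb Q$) by conjunction, disjunction and the bounded quantifiers $\exists_r x$, $\forall_r x$ ($\|x\|\le r$, $r$ a positive rational) over both sorts. An approximation $\varphi'$ of $\varphi$ is obtained by strictly relaxing every atomic condition, strictly enlarging the bound of every $\exists_r$ and strictly decreasing the (positive) bound of every $\forall_r$. Write $M\models_{\mathcal A}\varphi$ if $M\models\varphi'$ for every approximation $\varphi'$ of $\varphi$; a model of a set of sentences is a structure that satisfies all of them in the sense of $\models_{\mathcal A}$;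 and $\mathrm{Th}_{\mathcal A}(M)=\{\sigma: M\models_{\mathcal A}\sigma\}$. Let $T_G$ consist of the axioms saying that the space is a Hilbert space and that $g\mapsto\tau_g$ is a unitary representation of $G$ on it. Let $\lambda_G$ be the left regular representation of $G$ on $\ell^2(G)$, let $\infty\lambda_G$ on $H_{\infty\lambda_G}$ be the direct sum of countably infinitely many copies of it, and let $T_{GA}=\mathrm{Th}_{\mathcal A}(H_{\infty\lambda_G},+,\langle\cdot,\cdot\rangle,\infty\lambda_G)$. Let $\Sigma_G$ be the set of existential positive bounded sentences (a block of bounded existential quantifiers followed by a quantifier-free formula) true in $(H_{\infty\lambda_G},+,\langle\cdot,\cdot\rangle,\infty\lambda_G)$, and let $\Sigma_G^-$ be the set of all approximations of sentences in $\Sigma_G$. Theorem. Suppose that $G$ is amenable. Then: 1. $T_{GA}$ has quantifier elimination: for every positive bounded formula $\varphi(\bar x)$, every approximation $\varphi'$ of $\varphi$ and every rational $R>0$ there are a quantifier-free positive bounded formula $\psi(\bar x)$ and an approximation $\psi'$ of $\psi$ such that, for every model $M$ of $T_{GA}$ and every tuple $\bar a$ in $M$ with all entries of norm at most $R$, $M\models\varphi(\bar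 a)$ implies $M\models\psi(\bar a)$, and $M\models\psi'(\bar a)$ implies $M\models\varphi'(\bar a)$. 2. $T_{GA}$ is axiomatized by $T_G\cup\Sigma_G^-$: an $L_G$-structure is a model of $T_{GA}$ if and only if it is a model of $T_G\cup\Sigma_G^-$. 3. $T_{GA}$ is the model companion of $T_G$: every model of $T_G$ embeds in a model of $T_{GA}$, every model of $T_{GA}$ embeds in a model of $T_G$, and $T_{GA}$ is model complete, i.e. for every embedding $f:M\to N$ of models of $T_{GA}$, every positive bounded formula $\varphi$ and every tuple $\bar a$ in $M$, $M\models_{\mathcal A}\varphi(\bar a)$ if and only if $N\models_{\mathcal A}\varphi(f(\bar a))$ (scalar entries of $\bar a$ being left fixed). -/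

import Mathlib

universe u v w

noncomputable section

namespace HilbRep

/-! ### Amenable groups, unitary representations, the regular representation -/

/-- A discrete group is amenable if there is a left-invariant mean on `ℓ^∞(G)`: a positive
normalized linear functional that takes the same value at `f` and at the translate
`x ↦ f (g⁻¹ x)`. -/
def IsAmenable (G : Type u) [Group G] : Prop :=
  ∃ mean : lp (fun _ : G => ℝ) ⊤ →ₗ[ℝ] ℝ,
    mean 1 = 1 ∧
    (∀ f : lp (fun _ : G => ℝ) ⊤, (∀ x, 0 ≤ f x) → 0 ≤ mean f) ∧
    ∀ (g : G) (f f' : lp (fun _ : G => ℝ) ⊤), (∀ x, f' x = f (g⁻¹ * x)) → mean f' = mean f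

/-- A unitary representation of `G` on `H`: a homomorphism into the unitary group of `H`. -/
abbrev UnitaryRep (G : Type u) [Group G] (H : Type v) [NormedAddCommGroup H]
    [InnerProductSpace ℂ H] : Type (max u v) :=
  G →* (H ≃ₗᵢ[ℂ] H)

/-- The Hilbert space `ℓ²(G)`. -/
abbrev ellTwo (G : Type u) : Type u := lp (fun _ : G => ℂ) 2

theorem norm_sq_eq_tsum {ι : Type u} {E : ι → Type v} [∀ i, NormedAddCommGroup (E i)]
    (f : lp E 2) : ‖f‖ ^ 2 = ∑' i, ‖f i‖ ^ 2 := by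
  have h := lp.norm_rpow_eq_tsum (p := 2) (by norm_num) f
  simpa using h

theorem memlp_two_iff {ι : Type u} {E : ι → Type v} [∀ i, NormedAddCommGroup (E i)]
    (f : ∀ i, E i) : Memℓp f 2 ↔ Summable fun i => ‖f i‖ ^ 2 := by
  have h := memℓp_gen_iff (p := 2) (by norm_num) (f := f)
  simpa using h

/-- The translate `h ↦ f (g⁻¹ h)` of `f ∈ ℓ²(G)`. -/
def translate {G : Type u} [Group G] (g : G) (f : ellTwo G) : ellTwo G :=
  ⟨fun h => f (g⁻¹ * h), by
    have hf : Summable fun h => ‖f h‖ ^ 2 := (memlp_two_iff _).1 f.2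
    exact (memlp_two_iff (E := fun _ : G => ℂ) _).2
      (hf.comp_injective (mul_right_injective g⁻¹))⟩

theorem translate_apply {G : Type u} [Group G] (g : G) (f : ellTwo G) (h : G) :
    translate g f h = f (g⁻¹ * h) := rfl

/-- The translation by `g` as a unitary operator on `ℓ²(G)`. -/
def translateEquiv {G : Type u} [Group G] (g : G) : ellTwo G ≃ₗᵢ[ℂ] ellTwo G where
  toFun := translate g
  invFun := translate g⁻¹
  map_add' f f' := by ext h; rfl
  map_smul' c f := by ext h; rfl
  left_inv f := by ext h; simp [translate_apply]
  right_inv f := by ext h; simp [translate_apply]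
  norm_map' f := by
    have h : ‖translate g f‖ ^ 2 = ‖f‖ ^ 2 := by
      rw [norm_sq_eq_tsum, norm_sq_eq_tsum]
      exact (Equiv.mulLeft g⁻¹).tsum_eq (fun h => ‖f h‖ ^ 2)
    exact (sq_eq_sq₀ (norm_nonneg _) (norm_nonneg _)).1 h

/-- The left regular representation `λ_G` of `G` on `ℓ²(G)`. -/
def regularRep (G : Type u) [Group G] : UnitaryRep G (ellTwo G) where
  toFun g := translateEquiv g
  map_one' := by
    ext f h
    change f (1⁻¹ * h) = f h
    simp
  map_mul' g g' := by
    ext f h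
    change f ((g * g')⁻¹ * h) = f (g'⁻¹ * (g⁻¹ * h))
    simp [mul_assoc]

/-- The coordinatewise application of unitary operators on a Hilbert sum. -/
def sumMap {ι : Type u} {E : ι → Type v} [∀ i, NormedAddCommGroup (E i)]
    [∀ i, InnerProductSpace ℂ (E i)] (U : ∀ i, E i ≃ₗᵢ[ℂ] E i) (f : lp E 2) : lp E 2 :=
  ⟨fun i => U i (f i), by
    have hf : Summable fun i => ‖f i‖ ^ 2 := (memlp_two_iff _).1 f.2
    exact (memlp_two_iff _).2 (by simpa using hf)⟩

theorem sumMap_apply {ι : Type u} {E : ι → Type v} [∀ i, NormedAddCommGroup (E i)]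
    [∀ i, InnerProductSpace ℂ (E i)] (U : ∀ i, E i ≃ₗᵢ[ℂ] E i) (f : lp E 2) (i : ι) :
    sumMap U f i = U i (f i) := rfl

/-- The direct sum of unitary operators as a unitary operator on the Hilbert sum. -/
def sumEquiv {ι : Type u} {E : ι → Type v} [∀ i, NormedAddCommGroup (E i)]
    [∀ i, InnerProductSpace ℂ (E i)] (U : ∀ i, E i ≃ₗᵢ[ℂ] E i) : lp E 2 ≃ₗᵢ[ℂ] lp E 2 where
  toFun := sumMap U
  invFun := sumMap fun i => (U i).symm
  map_add' f f' := by ext i; exact map_add (U i) (f i) (f' i)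
  map_smul' c f := by ext i; exact map_smul (U i) c (f i)
  left_inv f := by ext i; simp [sumMap_apply]
  right_inv f := by ext i; simp [sumMap_apply]
  norm_map' f := by
    have h : ‖sumMap U f‖ ^ 2 = ‖f‖ ^ 2 := by
      rw [norm_sq_eq_tsum, norm_sq_eq_tsum]
      simp [sumMap_apply]
    exact (sq_eq_sq₀ (norm_nonneg _) (norm_nonneg _)).1 h

/-- The direct sum `⊕ᵢ πᵢ` of a family of unitary representations. -/
def directSum {G : Type w} [Group G] {ι : Type u} {E : ι → Type v}
    [∀ i, NormedAddCommGroup (E i)] [∀ i, InnerProductSpace ℂ (E i)]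
    (π : ∀ i, UnitaryRep G (E i)) : UnitaryRep G (lp E 2) where
  toFun g := sumEquiv fun i => π i g
  map_one' := by
    ext f i
    change (π i 1) (f i) = f i
    simp
  map_mul' g g' := by
    ext f i
    change (π i (g * g')) (f i) = (π i g) ((π i g') (f i))
    simp

/-- The Hilbert space of `∞λ_G`. -/
abbrev InftyRegularSpace (G : Type u) : Type u := lp (fun _ : ℕ => ellTwo G) 2

/-- The representation `∞λ_G`, the direct sum of countably many copies of `λ_G`. -/
def inftyRegularRep (G : Type u) [Group G] : UnitaryRep G (InftyRegularSpace G) :=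
  directSum fun _ : ℕ => regularRep G

/-! ### Structures -/

/-- Structures for the language `L_G` of Hilbert spaces with unary functions `τ_g`, `g ∈ G`: a
complex Banach space with a binary complex-valued function and unary functions `τ_g`, all
uniformly continuous on bounded sets. The scalar sort is always the complex field. No axiom of
Hilbert spaces or of representations is built in: these make up the theory `theoryTG`. -/
structure LGStructure (G : Type u) where
  carrier : Type v
  [normedAddCommGroup : NormedAddCommGroup carrier]
  [normedSpace : NormedSpace ℂ carrier]
  [completeSpace : CompleteSpace carrier]
  ip : carrier → carrier → ℂ
  act : G → carrier → carrier
  ip_uniformContinuousOn : ∀ r : ℝ,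
    UniformContinuousOn (fun p : carrier × carrier => ip p.1 p.2) (Metric.closedBall 0 r)
  act_uniformContinuousOn : ∀ (g : G) (r : ℝ),
    UniformContinuousOn (act g) (Metric.closedBall 0 r)

attribute [instance] LGStructure.normedAddCommGroup LGStructure.normedSpace
  LGStructure.completeSpace

theorem inner_uniformContinuousOn {H : Type v} [NormedAddCommGroup H] [InnerProductSpace ℂ H]
    (r : ℝ) : UniformContinuousOn (fun p : H × H => inner ℂ p.1 p.2) (Metric.closedBall 0 r) := by
  rw [Metric.uniformContinuousOn_iff]
  intro ε hε
  refine ⟨ε / (2 * (|r| + 1)), by positivity, ?_⟩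
  rintro ⟨x, y⟩ hx ⟨x', y'⟩ hx' hd
  simp only [Metric.mem_closedBall, dist_zero_right, Prod.norm_mk, sup_le_iff] at hx hx'
  rw [Prod.dist_eq, max_lt_iff, dist_eq_norm, dist_eq_norm] at hd
  have h : inner ℂ x y - inner ℂ x' y' = inner ℂ (x - x') y + inner ℂ x' (y - y') := by
    rw [inner_sub_left, inner_sub_right]; ring
  have hr : r ≤ |r| := le_abs_self r
  have hpos : 0 < |r| + 1 := by positivity
  rw [dist_eq_norm, h]
  calc ‖inner ℂ (x - x') y + inner ℂ x' (y - y')‖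
      ≤ ‖x - x'‖ * ‖y‖ + ‖x'‖ * ‖y - y'‖ :=
        (norm_add_le _ _).trans (add_le_add (norm_inner_le_norm _ _) (norm_inner_le_norm _ _))
    _ ≤ ‖x - x'‖ * (|r| + 1) + (|r| + 1) * ‖y - y'‖ := by
        gcongr <;> linarith [hx.2, hx'.1]
    _ < ε / (2 * (|r| + 1)) * (|r| + 1) + (|r| + 1) * (ε / (2 * (|r| + 1))) := by
        have h1 := mul_lt_mul_of_pos_right hd.1 hpos
        have h2 := mul_lt_mul_of_pos_left hd.2 hpos
        exact add_lt_add h1 h2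
    _ = ε := by field_simp; ring

/-- The structure `(H, +, ⟨,⟩, π(g) : g ∈ G)` of a unitary representation. -/
abbrev ofRep {G : Type u} [Group G] {H : Type v} [NormedAddCommGroup H] [InnerProductSpace ℂ H]
    [CompleteSpace H] (π : UnitaryRep G H) : LGStructure.{u, v} G where
  carrier := H
  ip x y := inner ℂ x y
  act g x := π g x
  ip_uniformContinuousOn := inner_uniformContinuousOn
  act_uniformContinuousOn g _ := (π g).isometry.uniformContinuous.uniformContinuousOn

/-- The structure `(H_{∞λ_G}, +, ⟨,⟩, ∞λ_G)`. -/
def inftyRegular (G : Type u) [Group G] : LGStructure.{u, u} G := ofRep (inftyRegularRep G)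

/-! ### Terms and positive bounded formulas -/

/-- The two sorts: the Hilbert space and the complex field. -/
inductive Srt : Type
  | vec
  | scal

/-- Terms of `L_G` with `m` variables of the Hilbert space sort and `n` scalar variables. -/
inductive Term (G : Type u) (m n : ℕ) : Srt → Type u
  | vvar (i : Fin m) : Term G m n .vec
  | vzero : Term G m n .vec
  | vadd (s t : Term G m n .vec) : Term G m n .vec
  | vsmul (a : Term G m n .scal) (s : Term G m n .vec) : Term G m n .vec
  | vact (g : G) (s : Term G m n .vec) : Term G m n .vec
  | svar (j : Fin n) : Term G m n .scal
  | srat (q : ℚ) : Term G m n .scal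
  | simag : Term G m n .scal
  | sadd (a b : Term G m n .scal) : Term G m n .scal
  | smul (a b : Term G m n .scal) : Term G m n .scal
  | sconj (a : Term G m n .scal) : Term G m n .scal
  | sinner (s t : Term G m n .vec) : Term G m n .scal
  | snorm (s : Term G m n .vec) : Term G m n .scal

/-- The interpretation of the sorts in a structure (`ULift` only adjusts the universe). -/
def Srt.interp {G : Type u} (M : LGStructure.{u, v} G) : Srt → Type v
  | .vec => M.carrier
  | .scal => ULift.{v} ℂ

/-- The value of a term. -/
def Term.eval {G : Type u} {m n : ℕ} (M : LGStructure.{u, v} G) (x : Fin m → M.carrier)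
    (z : Fin n → ℂ) : {s : Srt} → Term G m n s → s.interp M
  | _, .vvar i => x i
  | _, .vzero => (0 : M.carrier)
  | _, .vadd s t =>
      let a : M.carrier := s.eval M x z
      let b : M.carrier := t.eval M x z
      a + b
  | _, .vsmul a s =>
      let c : ULift.{v} ℂ := a.eval M x z
      let b : M.carrier := s.eval M x z
      c.down • b
  | _, .vact g s => M.act g (s.eval M x z)
  | _, .svar j => ULift.up (z j)
  | _, .srat q => ULift.up (q : ℂ)
  | _, .simag => ULift.up Complex.I
  | _, .sadd a b =>
      let c : ULift.{v} ℂ := a.eval M x z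
      let d : ULift.{v} ℂ := b.eval M x z
      ULift.up (c.down + d.down)
  | _, .smul a b =>
      let c : ULift.{v} ℂ := a.eval M x z
      let d : ULift.{v} ℂ := b.eval M x z
      ULift.up (c.down * d.down)
  | _, .sconj a =>
      let c : ULift.{v} ℂ := a.eval M x z
      ULift.up (star c.down)
  | _, .sinner s t => ULift.up (M.ip (s.eval M x z) (t.eval M x z))
  | _, .snorm s =>
      let a : M.carrier := s.eval M x z
      ULift.up ((‖a‖ : ℝ) : ℂ)

/-- The value of a scalar term as a complex number. -/
def Term.scalar {G : Type u} {m n : ℕ} (M : LGStructure.{u, v} G) (x : Fin m → M.carrier)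
    (z : Fin n → ℂ) (t : Term G m n .scal) : ℂ :=
  ULift.down (t.eval M x z)

/-- Positive rational numbers, the bounds of quantifiers. -/
abbrev PosRat : Type := {q : ℚ // 0 < q}

/-- Positive bounded formulas with `m` free vector variables and `n` free scalar variables.
The atomic formulas are `Re t ≤ p` and `Re t ≥ p` for scalar terms `t` and rational `p`; all
quantifiers are bounded by a positive rational. A quantifier binds the variable with index `0`
of its sort. -/
inductive Formula (G : Type u) : ℕ → ℕ → Type u
  | le {m n : ℕ} (t : Term G m n .scal) (p : ℚ) : Formula G m n
  | ge {m n : ℕ} (t : Term G m n .scal) (p : ℚ) : Formula G m n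
  | and {m n : ℕ} (φ ψ : Formula G m n) : Formula G m n
  | or {m n : ℕ} (φ ψ : Formula G m n) : Formula G m n
  | exV {m n : ℕ} (r : PosRat) (φ : Formula G (m + 1) n) : Formula G m n
  | allV {m n : ℕ} (r : PosRat) (φ : Formula G (m + 1) n) : Formula G m n
  | exS {m n : ℕ} (r : PosRat) (φ : Formula G m (n + 1)) : Formula G m n
  | allS {m n : ℕ} (r : PosRat) (φ : Formula G m (n + 1)) : Formula G m n

/-- Satisfaction of a positive bounded formula. -/
def Formula.Realize {G : Type u} (M : LGStructure.{u, v} G) :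
    {m n : ℕ} → Formula G m n → (Fin m → M.carrier) → (Fin n → ℂ) → Prop
  | _, _, .le t p, x, z => (t.scalar M x z).re ≤ (p : ℝ)
  | _, _, .ge t p, x, z => (p : ℝ) ≤ (t.scalar M x z).re
  | _, _, .and φ ψ, x, z => φ.Realize M x z ∧ ψ.Realize M x z
  | _, _, .or φ ψ, x, z => φ.Realize M x z ∨ ψ.Realize M x z
  | _, _, .exV r φ, x, z =>
      ∃ y : M.carrier, ‖y‖ ≤ ((r : ℚ) : ℝ) ∧ φ.Realize M (Matrix.vecCons y x) z
  | _, _, .allV r φ, x, z =>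
      ∀ y : M.carrier, ‖y‖ ≤ ((r : ℚ) : ℝ) → φ.Realize M (Matrix.vecCons y x) z
  | _, _, .exS r φ, x, z =>
      ∃ c : ℂ, ‖c‖ ≤ ((r : ℚ) : ℝ) ∧ φ.Realize M x (Matrix.vecCons c z)
  | _, _, .allS r φ, x, z =>
      ∀ c : ℂ, ‖c‖ ≤ ((r : ℚ) : ℝ) → φ.Realize M x (Matrix.vecCons c z)

/-- `Approx φ φ'`: the formula `φ'` is an approximation of `φ`. -/
inductive Formula.Approx {G : Type u} : {m n : ℕ} → Formula G m n → Formula G m n → Prop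
  | le {m n : ℕ} {t : Term G m n .scal} {p p' : ℚ} (h : p < p') :
      Formula.Approx (.le t p) (.le t p')
  | ge {m n : ℕ} {t : Term G m n .scal} {p p' : ℚ} (h : p' < p) :
      Formula.Approx (.ge t p) (.ge t p')
  | and {m n : ℕ} {φ φ' ψ ψ' : Formula G m n} (h : Formula.Approx φ φ')
      (h' : Formula.Approx ψ ψ') : Formula.Approx (.and φ ψ) (.and φ' ψ')
  | or {m n : ℕ} {φ φ' ψ ψ' : Formula G m n} (h : Formula.Approx φ φ')
      (h' : Formula.Approx ψ ψ') : Formula.Approx (.or φ ψ) (.or φ' ψ')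
  | exV {m n : ℕ} {r r' : PosRat} {φ φ' : Formula G (m + 1) n} (hr : r < r')
      (h : Formula.Approx φ φ') : Formula.Approx (.exV r φ) (.exV r' φ')
  | allV {m n : ℕ} {r r' : PosRat} {φ φ' : Formula G (m + 1) n} (hr : r' < r)
      (h : Formula.Approx φ φ') : Formula.Approx (.allV r φ) (.allV r' φ')
  | exS {m n : ℕ} {r r' : PosRat} {φ φ' : Formula G m (n + 1)} (hr : r < r')
      (h : Formula.Approx φ φ') : Formula.Approx (.exS r φ) (.exS r' φ')
  | allS {m n : ℕ} {r r' : PosRat} {φ φ' : Formula G m (n + 1)} (hr : r' < r)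
      (h : Formula.Approx φ φ') : Formula.Approx (.allS r φ) (.allS r' φ')

/-- Approximate satisfaction: every approximation is satisfied. -/
def Formula.ApproxRealize {G : Type u} {m n : ℕ} (M : LGStructure.{u, v} G) (φ : Formula G m n)
    (x : Fin m → M.carrier) (z : Fin n → ℂ) : Prop :=
  ∀ φ' : Formula G m n, φ.Approx φ' → φ'.Realize M x z

/-- Quantifier-free formulas. -/
inductive Formula.IsQF {G : Type u} : {m n : ℕ} → Formula G m n → Prop
  | le {m n : ℕ} (t : Term G m n .scal) (p : ℚ) : Formula.IsQF (.le t p)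
  | ge {m n : ℕ} (t : Term G m n .scal) (p : ℚ) : Formula.IsQF (.ge t p)
  | and {m n : ℕ} {φ ψ : Formula G m n} (h : Formula.IsQF φ) (h' : Formula.IsQF ψ) :
      Formula.IsQF (.and φ ψ)
  | or {m n : ℕ} {φ ψ : Formula G m n} (h : Formula.IsQF φ) (h' : Formula.IsQF ψ) :
      Formula.IsQF (.or φ ψ)

/-- Existential formulas: a block of bounded existential quantifiers before a quantifier-free
formula. -/
inductive Formula.IsExistential {G : Type u} : {m n : ℕ} → Formula G m n → Prop
  | qf {m n : ℕ} {φ : Formula G m n} (h : φ.IsQF) : Formula.IsExistential φ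
  | exV {m n : ℕ} (r : PosRat) {φ : Formula G (m + 1) n} (h : Formula.IsExistential φ) :
      Formula.IsExistential (.exV r φ)
  | exS {m n : ℕ} (r : PosRat) {φ : Formula G m (n + 1)} (h : Formula.IsExistential φ) :
      Formula.IsExistential (.exS r φ)

/-! ### Theories -/

/-- Sentences of `L_G`. -/
abbrev Sentence (G : Type u) : Type u := Formula G 0 0

/-- Theories: sets of positive bounded sentences. -/
abbrev Theory (G : Type u) : Type u := Set (Sentence G)

/-- `M ⊨ σ`. -/
def Satisfies {G : Type u} (M : LGStructure.{u, v} G) (σ : Sentence G) : Prop :=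
  σ.Realize M ![] ![]

/-- `M ⊨_A σ`. -/
def ApproxSatisfies {G : Type u} (M : LGStructure.{u, v} G) (σ : Sentence G) : Prop :=
  σ.ApproxRealize M ![] ![]

/-- `M` is a model of `T`, in the sense of approximate satisfaction. -/
def IsModel {G : Type u} (M : LGStructure.{u, v} G) (T : Theory G) : Prop :=
  ∀ σ ∈ T, ApproxSatisfies M σ

/-- The approximate theory `Th_A(M)`. -/
def approxTheory {G : Type u} (M : LGStructure.{u, v} G) : Theory G :=
  {σ | ApproxSatisfies M σ}

/-- The formula `s = t` for vector terms, written `‖s + (-1) t‖ ≤ 0`. -/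
def eqV {G : Type u} {m n : ℕ} (s t : Term G m n .vec) : Formula G m n :=
  .le (.snorm (.vadd s (.vsmul (.srat (-1)) t))) 0

/-- The formula `a = b` for scalar terms, written `|a + (-1) b|² ≤ 0`. -/
def eqS {G : Type u} {m n : ℕ} (a b : Term G m n .scal) : Formula G m n :=
  .le (.smul (.sadd a (.smul (.srat (-1)) b)) (.sconj (.sadd a (.smul (.srat (-1)) b)))) 0

/-- The axioms of Hilbert spaces: `⟨,⟩` is an inner product (linear in the second argument) that
induces the norm. Each axiom is the family of its restrictions to balls of rational radius. -/
inductive theoryHilbert (G : Type u) : Sentence G → Prop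
  | inner_add (r : PosRat) : theoryHilbert G
      (.allV r (.allV r (.allV r (eqS (.sinner (.vvar 0) (.vadd (.vvar 1) (.vvar 2)))
        (.sadd (.sinner (.vvar 0) (.vvar 1)) (.sinner (.vvar 0) (.vvar 2)))))))
  | inner_smul (r : PosRat) : theoryHilbert G
      (.allV r (.allV r (.allS r (eqS (.sinner (.vvar 0) (.vsmul (.svar 0) (.vvar 1)))
        (.smul (.svar 0) (.sinner (.vvar 0) (.vvar 1)))))))
  | inner_conj (r : PosRat) : theoryHilbert G
      (.allV r (.allV r (eqS (.sconj (.sinner (.vvar 0) (.vvar 1)))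
        (.sinner (.vvar 1) (.vvar 0)))))
  | inner_self (r : PosRat) : theoryHilbert G
      (.allV r (eqS (.sinner (.vvar 0) (.vvar 0))
        (.smul (.snorm (.vvar 0)) (.snorm (.vvar 0)))))

/-- The axioms stating that each `τ_g` is an automorphism of the Hilbert space and that
`g ↦ τ_g` is a representation of `G` (so that `τ_g` is invertible with inverse `τ_{g⁻¹}`). -/
inductive theoryAction (G : Type u) [Group G] : Sentence G → Prop
  | act_add (g : G) (r : PosRat) : theoryAction G
      (.allV r (.allV r (eqV (.vact g (.vadd (.vvar 0) (.vvar 1)))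
        (.vadd (.vact g (.vvar 0)) (.vact g (.vvar 1))))))
  | act_smul (g : G) (r : PosRat) : theoryAction G
      (.allV r (.allS r (eqV (.vact g (.vsmul (.svar 0) (.vvar 0)))
        (.vsmul (.svar 0) (.vact g (.vvar 0))))))
  | act_inner (g : G) (r : PosRat) : theoryAction G
      (.allV r (.allV r (eqS (.sinner (.vact g (.vvar 0)) (.vact g (.vvar 1)))
        (.sinner (.vvar 0) (.vvar 1)))))
  | act_mul (g h : G) (r : PosRat) : theoryAction G
      (.allV r (eqV (.vact (g * h) (.vvar 0)) (.vact g (.vact h (.vvar 0)))))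
  | act_one (r : PosRat) : theoryAction G
      (.allV r (eqV (.vact 1 (.vvar 0)) (.vvar 0)))

/-- The theory `T_G` of Hilbert spaces with a unitary representation of `G`. -/
def theoryTG (G : Type u) [Group G] : Theory G :=
  {σ | theoryHilbert G σ ∨ theoryAction G σ}

/-- The theory `T_GA = Th_A(H_{∞λ_G}, +, ⟨,⟩, ∞λ_G)`. -/
def theoryTGA (G : Type u) [Group G] : Theory G := approxTheory (inftyRegular G)

/-- `Σ_G`: the existential sentences true in `(H_{∞λ_G}, +, ⟨,⟩, ∞λ_G)`. -/
def sigmaG (G : Type u) [Group G] : Theory G :=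
  {σ | σ.IsExistential ∧ Satisfies (inftyRegular G) σ}

/-- `Σ_G⁻`: the approximations of the sentences of `Σ_G`. -/
def sigmaGMinus (G : Type u) [Group G] : Theory G :=
  {σ' | ∃ σ ∈ sigmaG G, σ.Approx σ'}

/-! ### Quantifier elimination, axiomatizations, model companions -/

/-- `Γ` axiomatizes `T`: the two theories have the same models. -/
def Axiomatizes {G : Type u} (Γ T : Theory G) : Prop :=
  ∀ M : LGStructure.{u, v} G, IsModel M T ↔ IsModel M Γ

/-- Quantifier elimination for approximate theories: for every formula `φ` with an approximation
`φ'` and every bound `R` on the free variables there are a quantifier-free formula `ψ` and an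
approximation `ψ'` of it such that `φ → ψ` and `ψ' → φ'` hold in all models of `T` for all tuples
bounded by `R`. -/
def HasQE {G : Type u} (T : Theory G) : Prop :=
  ∀ (m n : ℕ) (φ φ' : Formula G m n), φ.Approx φ' → ∀ R : PosRat,
    ∃ ψ ψ' : Formula G m n, ψ.IsQF ∧ ψ.Approx ψ' ∧
      ∀ M : LGStructure.{u, v} G, IsModel M T →
        ∀ (x : Fin m → M.carrier) (z : Fin n → ℂ),
          (∀ i, ‖x i‖ ≤ ((R : ℚ) : ℝ)) → (∀ j, ‖z j‖ ≤ ((R : ℚ) : ℝ)) →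
            (φ.Realize M x z → ψ.Realize M x z) ∧ (ψ'.Realize M x z → φ'.Realize M x z)

/-- Embeddings of structures: linear isometries that preserve `⟨,⟩` and commute with the `τ_g`. -/
structure Embedding {G : Type u} (M : LGStructure.{u, v} G) (N : LGStructure.{u, w} G) where
  toLinearIsometry : M.carrier →ₗᵢ[ℂ] N.carrier
  map_ip : ∀ x y, N.ip (toLinearIsometry x) (toLinearIsometry y) = M.ip x y
  map_act : ∀ g x, toLinearIsometry (M.act g x) = N.act g (toLinearIsometry x)

/-- An embedding is approximately elementary if it preserves and reflects approximate satisfaction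
of all positive bounded formulas. -/
def Embedding.IsApproxElementary {G : Type u} {M : LGStructure.{u, v} G}
    {N : LGStructure.{u, w} G} (f : Embedding M N) : Prop :=
  ∀ (m n : ℕ) (φ : Formula G m n) (x : Fin m → M.carrier) (z : Fin n → ℂ),
    φ.ApproxRealize M x z ↔ φ.ApproxRealize N (fun i => f.toLinearIsometry (x i)) z

/-- A theory is model complete if all embeddings between its models are approximately
elementary. -/
def IsModelComplete {G : Type u} (T : Theory G) : Prop :=
  ∀ M N : LGStructure.{u, v} G, IsModel M T → IsModel N T →
    ∀ f : Embedding M N, f.IsApproxElementary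

/-- `T'` is a model companion of `T`: it is model complete, every model of `T` embeds in a model
of `T'` and every model of `T'` embeds in a model of `T`. -/
def IsModelCompanion {G : Type u} (T' T : Theory G) : Prop :=
  IsModelComplete.{u, v} T' ∧
  (∀ M : LGStructure.{u, v} G, IsModel M T →
    ∃ N : LGStructure.{u, max u v} G, IsModel N T' ∧ Nonempty (Embedding M N)) ∧
  (∀ M : LGStructure.{u, v} G, IsModel M T' →
    ∃ N : LGStructure.{u, max u v} G, IsModel N T ∧ Nonempty (Embedding M N))

end HilbRep

end

/-!
Amenability provides unit vectors of `ℓ²(G)` that are almost invariant under any given finite subset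
of `G`. Tensoring with them and using Fell's absorption principle `λ_G ⊗ π ≅ (dim π) λ_G`, every
tuple of vectors of every unitary representation `π` has approximate copies in `∞λ_G`, with nearly
the same matrix coefficients on a prescribed finite subset of `G`. The existence of such copies is
expressed by existential sentences, so `Σ_G⁻` carries them over to every model of `T_G ∪ Σ_G⁻`. As
arbitrarily many copies can be chosen in different summands of `∞λ_G`, a Bessel-type inequality
makes one of them almost orthogonal to any finitely many vectors given in advance.

Consequently, if two tuples in models of `T_G ∪ Σ_G⁻` have nearly the same inner products
`⟨xᵢ, τ_g xⱼ⟩`, then a vector added to the first tuple can be matched on the other side: a greedy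
approximation splits it into a linear combination of translates of the `xᵢ`, which is copied
literally, and a remainder almost orthogonal to those translates, which is replaced by an
approximate copy. This back-and-forth shows that the truth of a positive bounded formula is
determined, up to approximation and uniformly over all models, by finitely many inner products; this
gives axiomatization, quantifier elimination and model completeness.
-/

noncomputable section

namespace HilbRep

/-! ### Terms -/

section Terms

variable {G : Type u} {m n : ℕ} (M : LGStructure.{u, v} G) (x : Fin m → M.carrier) (z : Fin n → ℂ)

/-- The value of a vector term as an element of the carrier, the counterpart of `Term.scalar`. -/
def Term.vector (t : Term G m n .vec) : M.carrier := t.eval M x z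

@[simp] theorem Term.vector_vzero : (Term.vzero : Term G m n .vec).vector M x z = 0 := rfl
@[simp] theorem Term.vector_vadd (s t : Term G m n .vec) :
    (Term.vadd s t).vector M x z = s.vector M x z + t.vector M x z := rfl
@[simp] theorem Term.vector_vsmul (a : Term G m n .scal) (s : Term G m n .vec) :
    (Term.vsmul a s).vector M x z = a.scalar M x z • s.vector M x z := rfl
@[simp] theorem Term.vector_vact (g : G) (s : Term G m n .vec) :
    (Term.vact g s).vector M x z = M.act g (s.vector M x z) := rfl
@[simp] theorem Term.scalar_svar (j : Fin n) :
    (Term.svar j : Term G m n .scal).scalar M x z = z j := rfl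
@[simp] theorem Term.scalar_srat (q : ℚ) :
    (Term.srat q : Term G m n .scal).scalar M x z = (q : ℂ) := rfl
@[simp] theorem Term.scalar_sadd (a b : Term G m n .scal) :
    (Term.sadd a b).scalar M x z = a.scalar M x z + b.scalar M x z := rfl
@[simp] theorem Term.scalar_smul (a b : Term G m n .scal) :
    (Term.smul a b).scalar M x z = a.scalar M x z * b.scalar M x z := rfl
@[simp] theorem Term.scalar_sconj (a : Term G m n .scal) :
    (Term.sconj a).scalar M x z = star (a.scalar M x z) := rfl
@[simp] theorem Term.scalar_sinner (s t : Term G m n .vec) :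
    (Term.sinner s t).scalar M x z = M.ip (s.vector M x z) (t.vector M x z) := rfl
@[simp] theorem Term.scalar_snorm (s : Term G m n .vec) :
    (Term.snorm s).scalar M x z = ((‖s.vector M x z‖ : ℝ) : ℂ) := rfl

/-- The scalar term `|a - b|²`, in the syntactic form used by `eqS`. -/
def Term.distSq (a b : Term G m n .scal) : Term G m n .scal :=
  .smul (.sadd a (.smul (.srat (-1)) b)) (.sconj (.sadd a (.smul (.srat (-1)) b)))

variable {M x z}

theorem Term.re_scalar_distSq (a b : Term G m n .scal) :
    ((a.distSq b).scalar M x z).re = ‖a.scalar M x z - b.scalar M x z‖ ^ 2 := by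
  simp only [Term.distSq, Term.scalar_smul, Term.scalar_sconj, Term.scalar_sadd,
    Term.scalar_srat, Rat.cast_neg, Rat.cast_one, neg_mul, one_mul, ← sub_eq_add_neg]
  rw [Complex.star_def, Complex.mul_conj, Complex.ofReal_re, Complex.normSq_eq_norm_sq]

theorem realize_eqS {a b : Term G m n .scal} :
    (eqS a b).Realize M x z ↔ a.scalar M x z = b.scalar M x z := by
  change ((a.distSq b).scalar M x z).re ≤ ((0 : ℚ) : ℝ) ↔ _
  rw [Term.re_scalar_distSq, Rat.cast_zero, sq_nonpos_iff, norm_eq_zero, sub_eq_zero]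

theorem realize_eqV {s t : Term G m n .vec} :
    (eqV s t).Realize M x z ↔ s.vector M x z = t.vector M x z := by
  change ((Term.snorm (.vadd s (.vsmul (.srat (-1)) t))).scalar M x z).re ≤ ((0 : ℚ) : ℝ) ↔ _
  simp [← sub_eq_add_neg, sub_eq_zero]

end Terms

theorem norm_vecCons_le {E : Type v} [SeminormedAddCommGroup E] {m : ℕ} {y : E} {x : Fin m → E}
    {r : ℝ} (hr : 0 ≤ r) : ‖Matrix.vecCons y x‖ ≤ r ↔ ‖y‖ ≤ r ∧ ‖x‖ ≤ r := by
  simp [pi_norm_le_iff_of_nonneg hr, Fin.forall_fin_succ]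

/-! ### Approximations -/

section Approximations

theorem PosRat.exists_between {r r' : PosRat} (h : r < r') : ∃ s : PosRat, r < s ∧ s < r' := by
  obtain ⟨s, hs, hs'⟩ := _root_.exists_between (show (r : ℚ) < r' from h)
  exact ⟨⟨s, r.2.trans hs⟩, hs, hs'⟩

theorem PosRat.exists_ge_of_lt {a : ℝ} (ha : 0 ≤ a) {r : PosRat} (h : a < ((r : ℚ) : ℝ)) :
    ∃ s : PosRat, a ≤ ((s : ℚ) : ℝ) ∧ s < r := by
  obtain ⟨q, hq, hq'⟩ := exists_rat_btwn h
  exact ⟨⟨q, by exact_mod_cast ha.trans_lt hq⟩, hq.le, by exact_mod_cast hq'⟩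

theorem PosRat.exists_gt (a : ℝ) : ∃ s : PosRat, a < ((s : ℚ) : ℝ) := by
  obtain ⟨q, hq⟩ := exists_rat_gt (max a 0)
  exact ⟨⟨q, by exact_mod_cast (le_max_right a 0).trans_lt hq⟩, (le_max_left a 0).trans_lt hq⟩

variable {G : Type u} {M : LGStructure.{u, v} G} {m n : ℕ} {x : Fin m → M.carrier} {z : Fin n → ℂ}

theorem Formula.Approx.realize {φ φ' : Formula G m n} (h : φ.Approx φ') (hφ : φ.Realize M x z) :
    φ'.Realize M x z := by
  induction h with
  | le h => exact le_trans (show _ ≤ _ from hφ) (by exact_mod_cast h.le)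
  | ge h => exact le_trans (by exact_mod_cast h.le) (show _ ≤ _ from hφ)
  | and _ _ ih ih' => exact ⟨ih hφ.1, ih' hφ.2⟩
  | or _ _ ih ih' => exact hφ.imp ih ih'
  | exV hr _ ih =>
    obtain ⟨y, hy, hφ⟩ := hφ
    exact ⟨y, hy.trans (by exact_mod_cast hr.le), ih hφ⟩
  | allV hr _ ih => exact fun y hy => ih (hφ y (hy.trans (by exact_mod_cast hr.le)))
  | exS hr _ ih =>
    obtain ⟨c, hc, hφ⟩ := hφ
    exact ⟨c, hc.trans (by exact_mod_cast hr.le), ih hφ⟩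
  | allS hr _ ih => exact fun c hc => ih (hφ c (hc.trans (by exact_mod_cast hr.le)))

theorem Formula.Realize.approxRealize {φ : Formula G m n} (hφ : φ.Realize M x z) :
    φ.ApproxRealize M x z :=
  fun _ h => h.realize hφ

theorem Formula.Approx.exists_between {φ φ' : Formula G m n} (h : φ.Approx φ') :
    ∃ ψ, φ.Approx ψ ∧ ψ.Approx φ' := by
  induction h with
  | le h =>
    obtain ⟨q, hq, hq'⟩ := _root_.exists_between h
    exact ⟨_, .le hq, .le hq'⟩
  | ge h =>
    obtain ⟨q, hq, hq'⟩ := _root_.exists_between h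
    exact ⟨_, .ge hq', .ge hq⟩
  | and _ _ ih ih' =>
    obtain ⟨_, h₁, h₁'⟩ := ih
    obtain ⟨_, h₂, h₂'⟩ := ih'
    exact ⟨_, .and h₁ h₂, .and h₁' h₂'⟩
  | or _ _ ih ih' =>
    obtain ⟨_, h₁, h₁'⟩ := ih
    obtain ⟨_, h₂, h₂'⟩ := ih'
    exact ⟨_, .or h₁ h₂, .or h₁' h₂'⟩
  | exV hr _ ih =>
    obtain ⟨_, h, h'⟩ := ih
    obtain ⟨_, hs, hs'⟩ := PosRat.exists_between hr
    exact ⟨_, .exV hs h, .exV hs' h'⟩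
  | allV hr _ ih =>
    obtain ⟨_, h, h'⟩ := ih
    obtain ⟨_, hs, hs'⟩ := PosRat.exists_between hr
    exact ⟨_, .allV hs' h, .allV hs h'⟩
  | exS hr _ ih =>
    obtain ⟨_, h, h'⟩ := ih
    obtain ⟨_, hs, hs'⟩ := PosRat.exists_between hr
    exact ⟨_, .exS hs h, .exS hs' h'⟩
  | allS hr _ ih =>
    obtain ⟨_, h, h'⟩ := ih
    obtain ⟨_, hs, hs'⟩ := PosRat.exists_between hr
    exact ⟨_, .allS hs' h, .allS hs h'⟩

theorem Formula.ApproxRealize.of_allV {r : PosRat} {φ : Formula G (m + 1) n}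
    (h : (Formula.allV r φ).ApproxRealize M x z) (y : M.carrier) (hy : ‖y‖ < ((r : ℚ) : ℝ)) :
    φ.ApproxRealize M (Matrix.vecCons y x) z := by
  intro φ' hφ'
  obtain ⟨s, hs, hsr⟩ := PosRat.exists_ge_of_lt (norm_nonneg y) hy
  exact h _ (.allV hsr hφ') y hs

theorem Formula.ApproxRealize.of_allS {r : PosRat} {φ : Formula G m (n + 1)}
    (h : (Formula.allS r φ).ApproxRealize M x z) (c : ℂ) (hc : ‖c‖ < ((r : ℚ) : ℝ)) :
    φ.ApproxRealize M x (Matrix.vecCons c z) := by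
  intro φ' hφ'
  obtain ⟨s, hs, hsr⟩ := PosRat.exists_ge_of_lt (norm_nonneg c) hc
  exact h _ (.allS hsr hφ') c hs

theorem Formula.ApproxRealize.realize_le {t : Term G m n .scal} {p : ℚ}
    (h : (Formula.le t p).ApproxRealize M x z) : (Formula.le t p).Realize M x z := by
  refine le_of_forall_gt fun b hb => ?_
  obtain ⟨q, hq, hq'⟩ := exists_rat_btwn hb
  exact lt_of_le_of_lt (h _ (.le (by exact_mod_cast hq))) hq'

theorem Formula.ApproxRealize.eqS {a b : Term G m n .scal} (h : (eqS a b).ApproxRealize M x z) :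
    a.scalar M x z = b.scalar M x z :=
  realize_eqS.1 h.realize_le

theorem Formula.ApproxRealize.eqV {s t : Term G m n .vec} (h : (eqV s t).ApproxRealize M x z) :
    s.vector M x z = t.vector M x z :=
  realize_eqV.1 h.realize_le

end Approximations

theorem IsModel.mono {G : Type u} {M : LGStructure.{u, v} G} {T T' : Theory G}
    (hM : IsModel M T') (hT : T ⊆ T') : IsModel M T :=
  fun σ hσ => hM σ (hT hσ)

theorem isModel_union {G : Type u} {M : LGStructure.{u, v} G} {T T' : Theory G} :
    IsModel M (T ∪ T') ↔ IsModel M T ∧ IsModel M T' := by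
  simp only [IsModel, Set.mem_union, or_imp, forall_and]

/-! ### Models of `T_G` are unitary representations -/

section ModelsTG

variable {G : Type u} [Group G]

theorem isModel_theoryTG_ofRep {H : Type v} [NormedAddCommGroup H] [InnerProductSpace ℂ H]
    [CompleteSpace H] (π : UnitaryRep G H) : IsModel (ofRep π) (theoryTG G) := by
  rintro σ (hσ | hσ) <;> refine Formula.Realize.approxRealize ?_
  · cases hσ with
    | inner_add r => exact fun x _ y _ w _ => realize_eqS.2 (by simp)
    | inner_smul r => exact fun x _ y _ c _ => realize_eqS.2 (by simp)
    | inner_conj r => exact fun x _ y _ => realize_eqS.2 (by simp)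
    | inner_self r => exact fun x _ => realize_eqS.2 (by simp [inner_self_eq_norm_sq_to_K, sq])
  · cases hσ with
    | act_add g r => exact fun x _ y _ => realize_eqV.2 (by simp)
    | act_smul g r => exact fun x _ c _ => realize_eqV.2 (by simp)
    | act_inner g r => exact fun x _ y _ => realize_eqS.2 (by simp)
    | act_mul g h r => exact fun x _ => realize_eqV.2 (by simp)
    | act_one r => exact fun x _ => realize_eqV.2 (by simp)

variable {M : LGStructure.{u, v} G} (hM : IsModel M (theoryTG G))

include hM

theorem IsModel.ip_add_right (x y w : M.carrier) : M.ip x (y + w) = M.ip x y + M.ip x w := by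
  obtain ⟨r, hr⟩ := PosRat.exists_gt (max ‖x‖ (max ‖y‖ ‖w‖))
  simp only [max_lt_iff] at hr
  exact ((((hM _ (.inl (.inner_add r))).of_allV w hr.2.2).of_allV y hr.2.1).of_allV x hr.1).eqS

theorem IsModel.ip_smul_right (c : ℂ) (x y : M.carrier) : M.ip x (c • y) = c * M.ip x y := by
  obtain ⟨r, hr⟩ := PosRat.exists_gt (max ‖x‖ (max ‖y‖ ‖c‖))
  simp only [max_lt_iff] at hr
  exact ((((hM _ (.inl (.inner_smul r))).of_allV y hr.2.1).of_allV x hr.1).of_allS c hr.2.2).eqS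

theorem IsModel.star_ip (x y : M.carrier) : star (M.ip x y) = M.ip y x := by
  obtain ⟨r, hr⟩ := PosRat.exists_gt (max ‖x‖ ‖y‖)
  simp only [max_lt_iff] at hr
  exact (((hM _ (.inl (.inner_conj r))).of_allV y hr.2).of_allV x hr.1).eqS

theorem IsModel.ip_self (x : M.carrier) : M.ip x x = (‖x‖ : ℂ) * ‖x‖ := by
  obtain ⟨r, hr⟩ := PosRat.exists_gt ‖x‖
  exact ((hM _ (.inl (.inner_self r))).of_allV x hr).eqS

theorem IsModel.act_add (g : G) (x y : M.carrier) : M.act g (x + y) = M.act g x + M.act g y := by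
  obtain ⟨r, hr⟩ := PosRat.exists_gt (max ‖x‖ ‖y‖)
  simp only [max_lt_iff] at hr
  exact (((hM _ (.inr (.act_add g r))).of_allV y hr.2).of_allV x hr.1).eqV

theorem IsModel.act_smul (g : G) (c : ℂ) (x : M.carrier) : M.act g (c • x) = c • M.act g x := by
  obtain ⟨r, hr⟩ := PosRat.exists_gt (max ‖x‖ ‖c‖)
  simp only [max_lt_iff] at hr
  exact (((hM _ (.inr (.act_smul g r))).of_allV x hr.1).of_allS c hr.2).eqV

theorem IsModel.ip_act_act (g : G) (x y : M.carrier) :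
    M.ip (M.act g x) (M.act g y) = M.ip x y := by
  obtain ⟨r, hr⟩ := PosRat.exists_gt (max ‖x‖ ‖y‖)
  simp only [max_lt_iff] at hr
  exact (((hM _ (.inr (.act_inner g r))).of_allV y hr.2).of_allV x hr.1).eqS

theorem IsModel.act_mul (g h : G) (x : M.carrier) : M.act (g * h) x = M.act g (M.act h x) := by
  obtain ⟨r, hr⟩ := PosRat.exists_gt ‖x‖
  exact ((hM _ (.inr (.act_mul g h r))).of_allV x hr).eqV

theorem IsModel.act_one (x : M.carrier) : M.act 1 x = x := by
  obtain ⟨r, hr⟩ := PosRat.exists_gt ‖x‖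
  exact ((hM _ (.inr (.act_one r))).of_allV x hr).eqV

theorem IsModel.norm_act (g : G) (x : M.carrier) : ‖M.act g x‖ = ‖x‖ := by
  have h := hM.ip_act_act g x x
  rw [hM.ip_self, hM.ip_self] at h
  exact (mul_self_inj (norm_nonneg _) (norm_nonneg _)).1 (by exact_mod_cast h)

/-- The inner product space whose inner product is the function `⟨·,·⟩` of a model of `T_G`. -/
abbrev IsModel.innerProductSpace : InnerProductSpace ℂ M.carrier :=
  { M.normedSpace with
    inner := M.ip
    norm_sq_eq_re_inner := fun x => by simp [hM.ip_self, sq]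
    conj_inner_symm := fun x y => hM.star_ip y x
    add_left := fun x y w => by
      rw [← hM.star_ip, hM.ip_add_right, star_add, hM.star_ip, hM.star_ip]
    smul_left := fun x y c => by
      rw [← hM.star_ip, hM.ip_smul_right, star_mul', hM.star_ip]; rfl }

/-- The unitary representation given by the functions `τ_g` of a model of `T_G`. -/
def IsModel.unitaryRep : letI := hM.innerProductSpace; UnitaryRep G M.carrier :=
  letI := hM.innerProductSpace
  { toFun := fun g =>
      { toFun := M.act g
        invFun := M.act g⁻¹
        map_add' := hM.act_add g
        map_smul' := hM.act_smul g
        left_inv := fun x => by rw [← hM.act_mul, inv_mul_cancel, hM.act_one]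
        right_inv := fun x => by rw [← hM.act_mul, mul_inv_cancel, hM.act_one]
        norm_map' := hM.norm_act g }
    map_one' := LinearIsometryEquiv.ext hM.act_one
    map_mul' := fun g h => LinearIsometryEquiv.ext (hM.act_mul g h) }

theorem IsModel.exists_eq_ofRep :
    ∃ (H : Type v) (_ : NormedAddCommGroup H) (_ : InnerProductSpace ℂ H) (_ : CompleteSpace H)
      (π : UnitaryRep G H), M = ofRep π :=
  ⟨M.carrier, M.normedAddCommGroup, hM.innerProductSpace, M.completeSpace, hM.unitaryRep, rfl⟩

end ModelsTG

/-! ### Embeddings -/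

section Embeddings

/-- The embedding of structures given by an intertwining isometry of unitary representations. -/
def Embedding.ofIntertwining {G : Type u} [Group G] {H : Type v} {K : Type w}
    [NormedAddCommGroup H] [InnerProductSpace ℂ H] [CompleteSpace H]
    [NormedAddCommGroup K] [InnerProductSpace ℂ K] [CompleteSpace K]
    {π : UnitaryRep G H} {ρ : UnitaryRep G K} (f : H →ₗᵢ[ℂ] K)
    (hf : ∀ g x, f (π g x) = ρ g (f x)) : Embedding (ofRep π) (ofRep ρ) where
  toLinearIsometry := f
  map_ip := f.inner_map_map
  map_act := hf

variable {G : Type u} {M : LGStructure.{u, v} G} {N : LGStructure.{u, w} G} (f : Embedding M N)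
  {m n : ℕ} {x : Fin m → M.carrier} {z : Fin n → ℂ}

theorem Embedding.eval_eq {s : Srt} (t : Term G m n s) :
    match s, t with
    | .vec, t => t.vector N (fun i => f.toLinearIsometry (x i)) z =
        f.toLinearIsometry (t.vector M x z)
    | .scal, t => t.scalar N (fun i => f.toLinearIsometry (x i)) z = t.scalar M x z := by
  induction t with
  | vvar | svar | srat | simag => rfl
  | vzero => simp
  | vadd | vsmul | sadd | smul | sconj | snorm => simp_all
  | vact => simp_all [f.map_act]
  | sinner => simp_all [f.map_ip]

theorem Embedding.scalar_eq (t : Term G m n .scal) :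
    t.scalar N (fun i => f.toLinearIsometry (x i)) z = t.scalar M x z :=
  f.eval_eq t

theorem Embedding.realize_of_isQF {φ : Formula G m n} (hφ : φ.IsQF) (h : φ.Realize M x z) :
    φ.Realize N (fun i => f.toLinearIsometry (x i)) z := by
  induction hφ with
  | le t p => change _ ≤ _; rwa [f.scalar_eq]
  | ge t p => change _ ≤ _; rwa [f.scalar_eq]
  | and _ _ ih ih' => exact ⟨ih h.1, ih' h.2⟩
  | or _ _ ih ih' => exact Or.imp ih ih' h

theorem Embedding.realize_of_isExistential {φ : Formula G m n} (hφ : φ.IsExistential)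
    (h : φ.Realize M x z) : φ.Realize N (fun i => f.toLinearIsometry (x i)) z := by
  induction hφ with
  | qf hφ => exact f.realize_of_isQF hφ h
  | exV r _ ih =>
    obtain ⟨y, hy, h⟩ := h
    refine ⟨f.toLinearIsometry y, by simpa using hy, ?_⟩
    convert ih h using 1
    exact (Fin.comp_cons f.toLinearIsometry y x).symm
  | exS r _ ih =>
    obtain ⟨c, hc, h⟩ := h
    exact ⟨c, hc, ih h⟩

end Embeddings

/-! ### Boxes -/

section Boxes

/-- The complex number with given rational real and imaginary parts. -/
def ratComplex (q : ℚ × ℚ) : ℂ := q.1 + q.2 * Complex.I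

theorem denseRange_ratComplex : DenseRange ratComplex := by
  have h : DenseRange (Complex.equivRealProdCLM.symm ∘ Prod.map ((↑) : ℚ → ℝ) ((↑) : ℚ → ℝ)) :=
    Complex.equivRealProdCLM.symm.surjective.denseRange.comp
      (Rat.denseRange_cast.prodMap Rat.denseRange_cast) (map_continuous _)
  convert h using 1
  ext q; simp [ratComplex, Complex.equivRealProdCLM_symm_apply]

variable {G : Type u} {m n : ℕ}

/-- A closed term with value `ratComplex q`. -/
def Term.ofRat (q : ℚ × ℚ) : Term G m n .scal := .sadd (.srat q.1) (.smul (.srat q.2) .simag)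

theorem Term.scalar_ofRat {M : LGStructure.{u, v} G} {x : Fin m → M.carrier} {z : Fin n → ℂ}
    (q : ℚ × ℚ) : (Term.ofRat q : Term G m n .scal).scalar M x z = ratComplex q := rfl

variable {ι : Type w} [Fintype ι]

/-- The quantifier-free formula stating that the values of a finite family `t` of scalar terms lie
in the closed polydisc of radius `ε` with the rational centre `q`. -/
def boxFormula (t : ι → Term G m n .scal) (q : ι → ℚ × ℚ) (ε : ℚ) : Formula G m n :=
  Finset.univ.toList.foldr (fun i φ => .and (.le ((t i).distSq (.ofRat (q i))) (ε ^ 2)) φ)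
    (.le (.srat 0) ε)

theorem boxFormula_isQF (t : ι → Term G m n .scal) (q : ι → ℚ × ℚ) (ε : ℚ) :
    (boxFormula t q ε).IsQF := by
  rw [boxFormula]
  induction (Finset.univ : Finset ι).toList with
  | nil => exact .le _ _
  | cons i l ih => exact .and (.le _ _) ih

theorem boxFormula_approx (t : ι → Term G m n .scal) (q : ι → ℚ × ℚ) {ε ε' : ℚ} (hε : 0 ≤ ε)
    (h : ε < ε') : (boxFormula t q ε).Approx (boxFormula t q ε') := by
  rw [boxFormula, boxFormula]
  induction (Finset.univ : Finset ι).toList with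
  | nil => exact .le h
  | cons i l ih => exact .and (.le (pow_lt_pow_left₀ h hε two_ne_zero)) ih

theorem realize_boxFormula {t : ι → Term G m n .scal} {q : ι → ℚ × ℚ} {ε : ℚ} (hε : 0 ≤ ε)
    {M : LGStructure.{u, v} G} {x : Fin m → M.carrier} {z : Fin n → ℂ} :
    (boxFormula t q ε).Realize M x z ↔
      dist (fun i => (t i).scalar M x z) (fun i => ratComplex (q i)) ≤ ε := by
  have key : ∀ l : List ι, (l.foldr (fun i φ => Formula.and
      (.le ((t i).distSq (.ofRat (q i))) (ε ^ 2)) φ) (.le (.srat 0) ε)).Realize M x z ↔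
      ∀ i ∈ l, dist ((t i).scalar M x z) (ratComplex (q i)) ≤ ε := by
    intro l
    induction l with
    | nil => simpa [Formula.Realize] using hε
    | cons i l ih =>
      rw [List.forall_mem_cons, ← ih, dist_eq_norm, ← Term.scalar_ofRat (M := M) (x := x) (z := z),
        ← sq_le_sq₀ (norm_nonneg _) (by exact_mod_cast hε), ← Term.re_scalar_distSq,
        ← Rat.cast_pow]
      rfl
  simp [boxFormula, key, dist_pi_le_iff (show (0 : ℝ) ≤ ε by exact_mod_cast hε)]

/-- The disjunction of a list of formulas. -/
def disjunction : List (Formula G m n) → Formula G m n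
  | [] => .le (.srat 1) 0
  | φ :: l => .or φ (disjunction l)

theorem disjunction_isQF {l : List (Formula G m n)} (h : ∀ φ ∈ l, φ.IsQF) :
    (disjunction l).IsQF := by
  induction l with
  | nil => exact .le _ _
  | cons φ l ih =>
    rw [List.forall_mem_cons] at h
    exact .or h.1 (ih h.2)

theorem realize_disjunction {M : LGStructure.{u, v} G} {x : Fin m → M.carrier} {z : Fin n → ℂ}
    {l : List (Formula G m n)} :
    (disjunction l).Realize M x z ↔ ∃ φ ∈ l, φ.Realize M x z := by
  induction l with
  | nil => simp [disjunction, Formula.Realize]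
  | cons φ l ih => rw [List.exists_mem_cons_iff, ← ih]; rfl

theorem exists_approx_disjunction {ι : Type w} (l : List ι) {φ φ' : ι → Formula G m n}
    (h : ∀ i, (φ i).Approx (φ' i)) :
    ∃ ψ', (disjunction (l.map φ)).Approx ψ' ∧
      ∀ (M : LGStructure.{u, v} G) (x : Fin m → M.carrier) (z : Fin n → ℂ),
        ψ'.Realize M x z → ∃ i ∈ l, (φ' i).Realize M x z := by
  induction l with
  | nil =>
    refine ⟨.le (.srat 1) (1 / 2), .le (by norm_num), fun M x z hx => ?_⟩
    change (((1 : ℚ) : ℂ)).re ≤ ((1 / 2 : ℚ) : ℝ) at hx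
    norm_num at hx
  | cons i l ih =>
    obtain ⟨ψ', hψ', H⟩ := ih
    refine ⟨.or (φ' i) ψ', .or (h i) hψ', fun M x z hx => ?_⟩
    simpa only [List.exists_mem_cons_iff] using hx.imp_right (H M x z)

end Boxes

/-! ### Transfer of finitely many values through `Σ_G⁻` -/

section ExistentialSentences

variable {G : Type u}

/-- The existential closure of a formula with `m` vector variables, with all quantifiers bounded
by `r`. -/
def exBlock (r : PosRat) : {m : ℕ} → Formula G m 0 → Sentence G
  | 0, φ => φ
  | _ + 1, φ => exBlock r (.exV r φ)

theorem exBlock_approx {r r' : PosRat} (hr : r < r') {m : ℕ} {φ φ' : Formula G m 0}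
    (h : φ.Approx φ') : (exBlock r φ).Approx (exBlock r' φ') := by
  induction m with
  | zero => exact h
  | succ m ih => exact ih (.exV hr h)

theorem exBlock_isExistential (r : PosRat) {m : ℕ} {φ : Formula G m 0} (h : φ.IsExistential) :
    (exBlock r φ).IsExistential := by
  induction m with
  | zero => exact h
  | succ m ih => exact ih (.exV r h)

theorem satisfies_exBlock {M : LGStructure.{u, v} G} {r : PosRat} {m : ℕ} {φ : Formula G m 0} :
    Satisfies M (exBlock r φ) ↔
      ∃ x : Fin m → M.carrier, ‖x‖ ≤ ((r : ℚ) : ℝ) ∧ φ.Realize M x ![] := by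
  have hr : (0 : ℝ) ≤ ((r : ℚ) : ℝ) := by exact_mod_cast r.2.le
  induction m with
  | zero =>
    refine ⟨fun h => ⟨![], (pi_norm_le_iff_of_nonneg hr).2 fun i => i.elim0, h⟩, ?_⟩
    rintro ⟨x, -, h⟩
    rwa [Subsingleton.elim x ![]] at h
  | succ m ih =>
    refine ih.trans ⟨?_, ?_⟩
    · rintro ⟨x, hx, y, hy, h⟩
      exact ⟨Matrix.vecCons y x, (norm_vecCons_le hr).2 ⟨hy, hx⟩, h⟩
    · rintro ⟨x, hx, h⟩
      rw [← Matrix.cons_head_tail x] at hx h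
      obtain ⟨hy, hx⟩ := (norm_vecCons_le hr).1 hx
      exact ⟨Matrix.vecTail x, hx, Matrix.vecHead x, hy, h⟩

theorem exists_dist_scalar_le_of_isModel_sigmaGMinus [Group G] {N : LGStructure.{u, v} G}
    (hN : IsModel N (sigmaGMinus G)) {m : ℕ} {ι : Type w} [Fintype ι]
    (t : ι → Term G m 0 .scal) (x : Fin m → (inftyRegular G).carrier) {ε : ℝ} (hε : 0 < ε) :
    ∃ y : Fin m → N.carrier, dist (fun i => (t i).scalar N y ![])
      (fun i => (t i).scalar (inftyRegular G) x ![]) ≤ ε := by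
  obtain ⟨δ, hδ, hδε⟩ := exists_rat_btwn (show (0 : ℝ) < ε / 4 by positivity)
  have hδ₀ : 0 < δ := by exact_mod_cast hδ
  obtain ⟨q, hq⟩ := (DenseRange.piMap fun _ : ι => denseRange_ratComplex).exists_dist_lt
    (fun i => (t i).scalar (inftyRegular G) x ![]) hδ
  obtain ⟨r, hr⟩ := PosRat.exists_gt ‖x‖
  obtain ⟨r', hr'⟩ := PosRat.exists_gt r
  obtain ⟨r'', hr''⟩ := PosRat.exists_gt r'
  have satisfied : Satisfies (inftyRegular G) (exBlock r (boxFormula t q δ)) :=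
    satisfies_exBlock.2 ⟨x, hr.le, (realize_boxFormula hδ₀.le).2 hq.le⟩
  have isExistential : (exBlock r (boxFormula t q δ)).IsExistential :=
    exBlock_isExistential r (.qf (boxFormula_isQF t q δ))
  have approx : (exBlock r (boxFormula t q δ)).Approx (exBlock r' (boxFormula t q (2 * δ))) :=
    exBlock_approx (by exact_mod_cast hr') (boxFormula_approx t q hδ₀.le (by linarith))
  have approx' : (exBlock r' (boxFormula t q (2 * δ))).Approx
      (exBlock r'' (boxFormula t q (3 * δ))) :=
    exBlock_approx (by exact_mod_cast hr'') (boxFormula_approx t q (by linarith) (by linarith))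
  obtain ⟨y, -, hy⟩ := satisfies_exBlock.1 (hN _ ⟨_, ⟨isExistential, satisfied⟩, approx⟩ _ approx')
  rw [realize_boxFormula (by linarith), Rat.cast_mul, Rat.cast_ofNat] at hy
  refine ⟨y, (dist_triangle_right _ _ fun i => ratComplex (q i)).trans ?_⟩
  exact (add_le_add hy hq.le).trans (by linarith)

end ExistentialSentences

/-! ### Almost invariant vectors of the regular representation -/

section Amenable

theorem exists_norm_linearCombination_lt {ι : Type u} {E : Type v} [NormedAddCommGroup E]
    [NormedSpace ℝ E] (s : ι → E)
    (hs : ∀ (Λ : StrongDual ℝ E) (c : ℝ), 0 < c → ∃ i, Λ (s i) < c) {ε : ℝ} (hε : 0 < ε) :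
    ∃ f : ι →₀ ℝ, (∀ i, 0 ≤ f i) ∧ f.sum (fun _ a => a) = 1 ∧
      ‖Finsupp.linearCombination ℝ s f‖ < ε := by
  classical
  let total : (ι →₀ ℝ) →ₗ[ℝ] ℝ := Finsupp.linearCombination ℝ fun _ => 1
  let weights : Set (ι →₀ ℝ) := {f | (∀ i, 0 ≤ f i) ∧ total f = 1}
  have convex : Convex ℝ weights := by
    refine fun f hf f' hf' a b ha hb hab => ⟨fun i => ?_, ?_⟩
    · exact add_nonneg (mul_nonneg ha (hf.1 i)) (mul_nonneg hb (hf'.1 i))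
    · rw [map_add, map_smul, map_smul, hf.2, hf'.2, ← add_smul, hab, one_smul]
  have not_disjoint :
      ¬ Disjoint (Metric.ball 0 ε) (Finsupp.linearCombination ℝ s '' weights) := by
    intro disjoint
    obtain ⟨Λ, c, hc, hΛ⟩ := geometric_hahn_banach_open (convex_ball 0 ε) Metric.isOpen_ball
      (convex.linear_image (Finsupp.linearCombination ℝ s)) disjoint
    obtain ⟨i, hi⟩ := hs Λ c (by simpa using hc 0 (Metric.mem_ball_self hε))
    refine hi.not_ge (hΛ _ ⟨Finsupp.single i 1, ⟨fun j => ?_, by simp [total]⟩, by simp⟩)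
    exact Finsupp.single_nonneg.2 zero_le_one j
  obtain ⟨_, hball, f, hf, rfl⟩ := Set.not_disjoint_iff.1 not_disjoint
  refine ⟨f, hf.1, ?_, mem_ball_zero_iff.1 hball⟩
  simpa [total, Finsupp.linearCombination_apply] using hf.2

theorem sum_sq_sqrt_sub_sqrt_le {ι : Type u} (s : Finset ι) {a b : ι → ℝ} (ha : ∀ i, 0 ≤ a i)
    (hb : ∀ i, 0 ≤ b i) : ∑ i ∈ s, (√(a i) - √(b i)) ^ 2 ≤ ∑ i ∈ s, |a i - b i| := by
  refine Finset.sum_le_sum fun i _ => ?_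
  have factor : a i - b i = (√(a i) - √(b i)) * (√(a i) + √(b i)) := by
    rw [mul_comm, ← sq_sub_sq, Real.sq_sqrt (ha i), Real.sq_sqrt (hb i)]
  have sqrt_nonneg := Real.sqrt_nonneg (a i)
  have sqrt_nonneg' := Real.sqrt_nonneg (b i)
  rw [factor, abs_mul, ← sq_abs, sq, abs_of_nonneg (add_nonneg sqrt_nonneg sqrt_nonneg')]
  gcongr
  exact abs_sub_le_iff.2 ⟨by linarith, by linarith⟩

variable {G : Type u} [Group G]

theorem IsAmenable.exists_sum_sub_lt (hG : IsAmenable G) {ι : Type v} [Fintype ι] (g : ι → G)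
    (a : ι → lp (fun _ : G => ℝ) ⊤) {c : ℝ} (hc : 0 < c) :
    ∃ h, ∑ i, (a i (g i * h) - a i h) < c := by
  obtain ⟨mean, mean_one, mean_nonneg, mean_translate⟩ := hG
  by_contra! large
  let b (i : ι) : lp (fun _ : G => ℝ) ⊤ := ⟨fun h => a i (g i * h), memℓp_infty
    ⟨‖a i‖, by rintro _ ⟨h, rfl⟩; exact lp.norm_apply_le_norm ENNReal.top_ne_zero (a i) _⟩⟩
  have mean_b (i : ι) : mean (b i) = mean (a i) :=
    mean_translate (g i)⁻¹ (a i) (b i) fun h => by rw [inv_inv]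
  have nonneg : 0 ≤ mean (∑ i, (b i - a i) - c • 1) := by
    refine mean_nonneg _ fun h => sub_nonneg.2 ?_
    rw [lp.coeFn_smul, lp.infty_coeFn_one, Pi.smul_apply, Pi.one_apply, smul_eq_mul, mul_one,
      lp.coeFn_sum, Finset.sum_apply]
    exact large h
  simp only [map_sub, map_sum, map_smul, mean_one, mean_b, sub_self, Finset.sum_const_zero,
    smul_eq_mul, mul_one, zero_sub, Left.nonneg_neg_iff] at nonneg
  exact hc.not_ge nonneg

open scoped Classical in
/-- The difference `δ_{gh} - δ_h` in `ℓ¹(G)`. -/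
def shiftDifference (g h : G) : lp (fun _ : G => ℝ) 1 := lp.single 1 (g * h) 1 - lp.single 1 h 1

theorem linearCombination_shiftDifference_apply {ι : Type v} (g : ι → G) (f : G →₀ ℝ) (i : ι)
    (k : G) : Finsupp.linearCombination ℝ (fun h i => shiftDifference (g i) h) f i k =
      f ((g i)⁻¹ * k) - f k := by
  classical
  induction f using Finsupp.induction_linear with
  | zero => simp
  | add f f' h h' =>
    simp only [map_add, Pi.add_apply, lp.coeFn_add, h, h', Finsupp.add_apply]
    ring
  | single h c =>
    have expand : (c • shiftDifference (g i) h) k =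
        c * ((Pi.single (g i * h) 1 : G → ℝ) k - (Pi.single h 1 : G → ℝ) k) := rfl
    simp only [Finsupp.linearCombination_single, Pi.smul_apply, expand, Pi.single_apply,
      Finsupp.single_apply, eq_inv_mul_iff_mul_eq, @eq_comm G k]
    split_ifs <;> simp

theorem IsAmenable.exists_lt_of_shiftDifference (hG : IsAmenable G) {ι : Type v} [Finite ι]
    (g : ι → G) (Λ : StrongDual ℝ (ι → lp (fun _ : G => ℝ) 1)) {c : ℝ} (hc : 0 < c) :
    ∃ h, Λ (fun i => shiftDifference (g i) h) < c := by
  classical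
  cases nonempty_fintype ι
  let a (i : ι) : lp (fun _ : G => ℝ) ⊤ := ⟨fun h => Λ (Pi.single i (lp.single 1 h 1)), by
    refine memℓp_infty ⟨‖Λ‖, ?_⟩
    rintro _ ⟨h, rfl⟩
    refine (Λ.le_opNorm _).trans_eq ?_
    rw [Pi.norm_single, lp.norm_single zero_lt_one, norm_one, mul_one]⟩
  obtain ⟨h, hh⟩ := hG.exists_sum_sub_lt g a hc
  have expand : Λ (fun i => shiftDifference (g i) h) = ∑ i, (a i (g i * h) - a i h) := by
    rw [← Finset.univ_sum_single fun i => shiftDifference (g i) h, map_sum]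
    refine Finset.sum_congr rfl fun i _ => ?_
    rw [shiftDifference, Pi.single_sub, map_sub]
  exact ⟨h, expand ▸ hh⟩

theorem IsAmenable.exists_almost_invariant_measure (hG : IsAmenable G) (F : Finset G) {ε : ℝ}
    (hε : 0 < ε) :
    ∃ f : G →₀ ℝ, (∀ k, 0 ≤ f k) ∧ f.sum (fun _ a => a) = 1 ∧
      ∀ g ∈ F, ∀ S : Finset G, ∑ k ∈ S, |f (g⁻¹ * k) - f k| ≤ ε := by
  obtain ⟨f, f_nonneg, f_sum, hf⟩ := exists_norm_linearCombination_lt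
    (fun h (g : F) => shiftDifference (g : G) h)
    (fun Λ c hc => hG.exists_lt_of_shiftDifference (fun g : F => (g : G)) Λ hc) hε
  refine ⟨f, f_nonneg, f_sum, fun g hg S => ?_⟩
  have sum_le := lp.sum_rpow_le_norm_rpow (p := 1) (by norm_num)
    (Finsupp.linearCombination ℝ (fun h (g : F) => shiftDifference (g : G) h) f ⟨g, hg⟩) S
  simp only [ENNReal.toReal_one, Real.rpow_one, Real.norm_eq_abs,
    linearCombination_shiftDifference_apply] at sum_le
  exact sum_le.trans ((norm_le_pi_norm _ (⟨g, hg⟩ : F)).trans hf.le)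

/-- `f ↦ √f` turns an almost invariant probability measure in `ℓ¹(G)` into a unit vector of
`ℓ²(G)`. -/
theorem IsAmenable.exists_almost_invariant_vector (hG : IsAmenable G) (F : Finset G) {ε : ℝ}
    (hε : 0 < ε) :
    ∃ ξ : G →₀ ℝ, ∀ g ∈ F, |ξ.sum (fun h a => a * ξ (g⁻¹ * h)) - 1| ≤ ε := by
  classical
  obtain ⟨f, f_nonneg, f_sum, hf⟩ := hG.exists_almost_invariant_measure F hε
  refine ⟨f.mapRange Real.sqrt Real.sqrt_zero, fun g hg => ?_⟩
  let S := f.support ∪ f.support.map (Equiv.mulLeft g).toEmbedding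
  have sum_f : ∑ k ∈ S, f k = 1 :=
    (Finsupp.sum_of_support_subset f Finset.subset_union_left _ fun _ _ => rfl).symm.trans f_sum
  have sum_f_shift : ∑ k ∈ S, f (g⁻¹ * k) = 1 := by
    rw [← f_sum, ← Finset.sum_subset (Finset.subset_union_right (s₁ := f.support))]
    · simp [Finsupp.sum, Finset.sum_map]
    · refine fun k _ hk => Finsupp.notMem_support_iff.1 fun h => hk ?_
      exact Finset.mem_map.2 ⟨_, h, by simp⟩
  have sum_coeff : (f.mapRange Real.sqrt Real.sqrt_zero).sum
      (fun h a => a * f.mapRange Real.sqrt Real.sqrt_zero (g⁻¹ * h)) =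
        ∑ k ∈ S, √(f k) * √(f (g⁻¹ * k)) := by
    refine (Finsupp.sum_mapRange_index fun _ => zero_mul _).trans ?_
    exact Finsupp.sum_of_support_subset f Finset.subset_union_left _ (by simp)
  have sum_sq : ∑ k ∈ S, (√(f (g⁻¹ * k)) - √(f k)) ^ 2 =
      2 - 2 * ∑ k ∈ S, √(f k) * √(f (g⁻¹ * k)) := by
    simp only [sub_sq, Real.sq_sqrt (f_nonneg _), Finset.sum_sub_distrib, Finset.sum_add_distrib,
      sum_f, sum_f_shift, mul_assoc, mul_comm (√(f (g⁻¹ * _))), ← Finset.mul_sum]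
    ring
  have sum_sq_nonneg : 0 ≤ ∑ k ∈ S, (√(f (g⁻¹ * k)) - √(f k)) ^ 2 :=
    Finset.sum_nonneg fun k _ => sq_nonneg _
  have sum_sq_le := (sum_sq_sqrt_sub_sqrt_le S (fun k => f_nonneg (g⁻¹ * k)) f_nonneg).trans
    (hf g hg S)
  rw [sum_coeff]
  exact abs_le.2 ⟨by linarith, by linarith⟩

end Amenable

/-! ### Orthogonal copies of a vector in `∞λ_G` -/

section Copies

variable {G : Type u} {d : ℕ}

open scoped Classical in
/-- The `i`-th copy in `∞λ_G` of the finitely supported vector `c` of `ℓ²(G) ⊗ ℂᵈ`. Different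
copies occupy disjoint blocks `{Nat.pair i j | j < d}` of summands, hence are orthogonal together
with their translates. -/
def copyVec (c : G →₀ Fin d → ℂ) (i : ℕ) : InftyRegularSpace G :=
  c.sum fun h v => ∑ j : Fin d, lp.single 2 (Nat.pair i j) (lp.single 2 h (v j))

theorem copyVec_apply (c : G →₀ Fin d → ℂ) (i i' : ℕ) (j : Fin d) (k : G) :
    copyVec c i (Nat.pair i' j) k = if i = i' then c k j else 0 := by
  classical
  have apply_single (h : G) (j' : Fin d) :
      (lp.single 2 (Nat.pair i j') (lp.single 2 h (c h j')) : InftyRegularSpace G)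
        (Nat.pair i' j) k = if h = k then if j' = j then if i = i' then c k j else 0 else 0
          else 0 := by
    simp only [lp.single_apply, Pi.single_apply, Nat.pair_eq_pair, Fin.val_inj]
    obtain rfl | hi := eq_or_ne i i'
    · obtain rfl | hj := eq_or_ne j' j
      · obtain rfl | hk := eq_or_ne h k
        · simp
        · simp [hk, hk.symm]
      · simp [hj, hj.symm]
    · simp [hi, hi.symm]
  have apply_sum : copyVec c i (Nat.pair i' j) k = ∑ h ∈ c.support, ∑ j' : Fin d,
      (lp.single 2 (Nat.pair i j') (lp.single 2 h (c h j')) : InftyRegularSpace G)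
        (Nat.pair i' j) k := by
    rw [copyVec, Finsupp.sum]
    simp only [lp.coeFn_sum, Finset.sum_apply]
  simp only [apply_sum, apply_single]
  by_cases hk : k ∈ c.support
  · simp [hk]
  · simp [Finsupp.notMem_support_iff.1 hk]

variable [Group G]

theorem inner_copyVec_left (c : G →₀ Fin d → ℂ) (i : ℕ) (g : G) (y : InftyRegularSpace G) :
    inner ℂ (copyVec c i) (inftyRegularRep G g y) =
      c.sum fun h v => ∑ j : Fin d, star (v j) * y (Nat.pair i j) (g⁻¹ * h) := by
  classical
  simp only [copyVec, Finsupp.sum, sum_inner]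
  refine Finset.sum_congr rfl fun h _ => Finset.sum_congr rfl fun j _ => ?_
  rw [lp.inner_single_left, lp.inner_single_left]
  exact mul_comm _ _

theorem inner_copyVec_copyVec (c : G →₀ Fin d → ℂ) (i i' : ℕ) (g : G) :
    inner ℂ (copyVec c i) (inftyRegularRep G g (copyVec c i')) =
      if i = i' then c.sum fun h v => ∑ j, star (v j) * c (g⁻¹ * h) j else 0 := by
  simp only [inner_copyVec_left, copyVec_apply]
  obtain rfl | hi := eq_or_ne i i'
  · simp
  · simp [hi, hi.symm]

variable {H : Type v} [NormedAddCommGroup H] [InnerProductSpace ℂ H]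

-- The coefficients are those of the image of `ξ ⊗ e` under Fell's isomorphism
-- `λ_G ⊗ π ≅ λ_G ⊗ 1_H`, `δ_h ⊗ x ↦ δ_h ⊗ π(h⁻¹) x`.
theorem exists_coefficients (π : UnitaryRep G H) (e : H) (ξ : G →₀ ℝ) :
    ∃ (d : ℕ) (c : G →₀ Fin d → ℂ), ∀ g, (c.sum fun h v => ∑ j, star (v j) * c (g⁻¹ * h) j) =
      (ξ.sum fun h a => a * ξ (g⁻¹ * h) : ℝ) * inner ℂ e (π g e) := by
  classical
  let W : Submodule ℂ H := Submodule.span ℂ ((fun h => π h⁻¹ e) '' (ξ.support : Set G))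
  have mem_W {h : G} (hh : h ∈ ξ.support) : π h⁻¹ e ∈ W := Submodule.subset_span ⟨h, hh, rfl⟩
  have : FiniteDimensional ℂ W :=
    FiniteDimensional.span_of_finite ℂ (ξ.support.finite_toSet.image _)
  let b := stdOrthonormalBasis ℂ W
  let c : G →₀ Fin (Module.finrank ℂ W) → ℂ := Finsupp.onFinset ξ.support
    (fun h j => ξ h * inner ℂ (b j : H) (π h⁻¹ e))
    fun h hc => Finsupp.mem_support_iff.2 fun hξ => hc (by ext j; simp [hξ])
  have support_c : c.support ⊆ ξ.support := Finsupp.support_onFinset_subset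
  have parseval {h k : G} (hh : h ∈ ξ.support) (hk : k ∈ ξ.support) :
      ∑ j, star (c h j) * c k j = (ξ h * ξ k : ℝ) * inner ℂ (π h⁻¹ e) (π k⁻¹ e) := by
    have := b.sum_inner_mul_inner ⟨_, mem_W hh⟩ ⟨_, mem_W hk⟩
    simp only [Submodule.coe_inner] at this
    rw [← this, Finset.mul_sum]
    refine Finset.sum_congr rfl fun j _ => ?_
    simp only [c, Finsupp.onFinset_apply, star_mul', Complex.star_def, Complex.conj_ofReal,
      inner_conj_symm]
    push_cast
    ring
  refine ⟨_, c, fun g => ?_⟩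
  rw [Finsupp.sum_of_support_subset c support_c _ (by simp), Finsupp.sum, Complex.ofReal_sum,
    Finset.sum_mul]
  refine Finset.sum_congr rfl fun h hh => ?_
  by_cases hk : g⁻¹ * h ∈ ξ.support
  · have translate : π (g⁻¹ * h)⁻¹ e = π h⁻¹ (π g e) := by simp
    rw [parseval hh hk, translate, (π h⁻¹).inner_map_map]
  · simp [c, Finsupp.notMem_support_iff.1 hk]

theorem IsAmenable.exists_orthogonal_copies (hG : IsAmenable G) (π : UnitaryRep G H) (e : H)
    (F : Finset G) {ε : ℝ} (hε : 0 < ε) :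
    ∃ f : ℕ → InftyRegularSpace G, ∀ i j, ∀ g ∈ F,
      ‖inner ℂ (f i) (inftyRegularRep G g (f j)) -
        if i = j then inner ℂ e (π g e) else 0‖ ≤ ε := by
  obtain ⟨ξ, hξ⟩ := hG.exists_almost_invariant_vector F (ε := ε / (‖e‖ ^ 2 + 1)) (by positivity)
  obtain ⟨d, c, hc⟩ := exists_coefficients π e ξ
  refine ⟨copyVec c, fun i j g hg => ?_⟩
  rw [inner_copyVec_copyVec, hc]
  split_ifs
  · have norm_inner_le : ‖inner ℂ e (π g e)‖ ≤ ‖e‖ ^ 2 + 1 := by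
      have := norm_inner_le_norm (𝕜 := ℂ) e (π g e)
      rw [(π g).norm_map, ← sq] at this
      exact this.trans (le_add_of_nonneg_right zero_le_one)
    rw [← sub_one_mul, norm_mul, ← Complex.ofReal_one, ← Complex.ofReal_sub, Complex.norm_real]
    calc _ ≤ ε / (‖e‖ ^ 2 + 1) * (‖e‖ ^ 2 + 1) :=
          mul_le_mul (hξ g hg) norm_inner_le (norm_nonneg _) (by positivity)
      _ = ε := div_mul_cancel₀ _ (by positivity)
  · simpa using hε.le

end Copies

/-! ### Almost orthogonal vectors -/

section AlmostOrthogonal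

variable {𝕜 : Type u} {E : Type v} [RCLike 𝕜] [NormedAddCommGroup E] [InnerProductSpace 𝕜 E]
  {ι : Type w} [Fintype ι] {d : ι → E} {C : ℝ}

-- Schur's test for the Gram matrix of `d`.
theorem norm_sum_smul_sq_le (hd : ∀ i, ∑ j, ‖inner 𝕜 (d i) (d j)‖ ≤ C) (c : ι → 𝕜) :
    ‖∑ i, c i • d i‖ ^ 2 ≤ C * ∑ i, ‖c i‖ ^ 2 := by
  have am_gm (i j : ι) : ‖c i‖ * ‖c j‖ ≤ (‖c i‖ ^ 2 + ‖c j‖ ^ 2) / 2 := by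
    linarith [two_mul_le_add_sq ‖c i‖ ‖c j‖]
  calc ‖∑ i, c i • d i‖ ^ 2
      = ‖∑ i, ∑ j, starRingEnd 𝕜 (c i) * (c j * inner 𝕜 (d i) (d j))‖ := by
        rw [← inner_self_eq_norm_sq (𝕜 := 𝕜), inner_self_re_eq_norm]
        simp only [sum_inner, inner_smul_left, inner_sum, inner_smul_right, Finset.mul_sum]
        rw [Finset.sum_comm]
        simp only [mul_left_comm (c _)]
    _ ≤ ∑ i, ∑ j, ‖starRingEnd 𝕜 (c i) * (c j * inner 𝕜 (d i) (d j))‖ :=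
        (norm_sum_le _ _).trans (Finset.sum_le_sum fun i _ => norm_sum_le _ _)
    _ = ∑ i, ∑ j, ‖c i‖ * ‖c j‖ * ‖inner 𝕜 (d i) (d j)‖ := by
        simp only [norm_mul, RCLike.norm_conj, mul_assoc]
    _ ≤ ∑ i, ∑ j, (‖c i‖ ^ 2 + ‖c j‖ ^ 2) / 2 * ‖inner 𝕜 (d i) (d j)‖ := by
        gcongr with i _ j
        exact am_gm i j
    _ = ∑ i, ‖c i‖ ^ 2 * ∑ j, ‖inner 𝕜 (d i) (d j)‖ := by
        have symm : ∑ i, ∑ j, ‖c j‖ ^ 2 * ‖inner 𝕜 (d i) (d j)‖ =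
            ∑ i, ∑ j, ‖c i‖ ^ 2 * ‖inner 𝕜 (d i) (d j)‖ := by
          rw [Finset.sum_comm]
          simp only [norm_inner_symm]
        simp only [add_div, add_mul, Finset.sum_add_distrib, div_mul_eq_mul_div,
          ← Finset.sum_div, symm, add_halves, Finset.mul_sum]
    _ ≤ ∑ i, ‖c i‖ ^ 2 * C := by
        gcongr with i
        exact hd i
    _ = C * ∑ i, ‖c i‖ ^ 2 := by rw [← Finset.sum_mul, mul_comm]

-- Bessel's inequality in the form of Bombieri and Boas, from the previous estimate by duality.
theorem sum_norm_inner_sq_le (hC : 0 ≤ C) (hd : ∀ i, ∑ j, ‖inner 𝕜 (d i) (d j)‖ ≤ C) (x : E) :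
    ∑ i, ‖inner 𝕜 (d i) x‖ ^ 2 ≤ C * ‖x‖ ^ 2 := by
  set s : ℝ := ∑ i, ‖inner 𝕜 (d i) x‖ ^ 2
  set y : E := ∑ i, inner 𝕜 (d i) x • d i
  have inner_y : inner 𝕜 y x = (s : 𝕜) := by
    simp only [y, s, sum_inner, inner_smul_left, RCLike.conj_mul]
    push_cast
    rfl
  have s_nonneg : 0 ≤ s := Finset.sum_nonneg fun i _ => sq_nonneg _
  have s_le : s ≤ ‖y‖ * ‖x‖ := by
    have := norm_inner_le_norm (𝕜 := 𝕜) y x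
    rwa [inner_y, RCLike.norm_of_nonneg s_nonneg] at this
  have sq_le : s * s ≤ C * ‖x‖ ^ 2 * s := by
    calc s * s ≤ (‖y‖ * ‖x‖) * (‖y‖ * ‖x‖) := by gcongr
      _ = ‖y‖ ^ 2 * ‖x‖ ^ 2 := by ring
      _ ≤ C * s * ‖x‖ ^ 2 := by gcongr; exact norm_sum_smul_sq_le hd _
      _ = C * ‖x‖ ^ 2 * s := by ring
  obtain s_zero | s_pos := s_nonneg.eq_or_lt
  · rw [← s_zero]
    positivity
  · exact le_of_mul_le_mul_right sq_le s_pos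

theorem exists_norm_inner_le_of_card {κ : Type*} [Fintype κ] (hC : 0 ≤ C)
    (hd : ∀ i, ∑ j, ‖inner 𝕜 (d i) (d j)‖ ≤ C) (b : κ → E) {ε : ℝ} (hε : 0 ≤ ε)
    (card_ι : C * ∑ k, ‖b k‖ ^ 2 < Fintype.card ι * ε ^ 2) :
    ∃ i, ∀ k, ‖inner 𝕜 (d i) (b k)‖ ≤ ε := by
  by_contra! large
  refine card_ι.not_ge ?_
  have sq_le (i : ι) : ε ^ 2 ≤ ∑ k, ‖inner 𝕜 (d i) (b k)‖ ^ 2 := by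
    obtain ⟨k, hk⟩ := large i
    exact (pow_le_pow_left₀ hε hk.le 2).trans <| Finset.single_le_sum
      (f := fun k => ‖inner 𝕜 (d i) (b k)‖ ^ 2) (fun k _ => sq_nonneg _) (Finset.mem_univ k)
  calc Fintype.card ι * ε ^ 2 = ∑ _i : ι, ε ^ 2 := by simp
    _ ≤ ∑ i, ∑ k, ‖inner 𝕜 (d i) (b k)‖ ^ 2 := Finset.sum_le_sum fun i _ => sq_le i
    _ = ∑ k, ∑ i, ‖inner 𝕜 (d i) (b k)‖ ^ 2 := Finset.sum_comm
    _ ≤ ∑ k, C * ‖b k‖ ^ 2 := Finset.sum_le_sum fun k _ => sum_norm_inner_sq_le hC hd (b k)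
    _ = C * ∑ k, ‖b k‖ ^ 2 := (Finset.mul_sum ..).symm

end AlmostOrthogonal

/-! ### Copies of vectors in models of `Σ_G⁻` -/

section ApproximateCopies

variable {G : Type u}

/-- Tuples in two structures are `(F, δ)`-close if their matrix coefficients at the elements of
`F` differ by at most `δ`. For varying `F` and `δ` these sets form a base of the uniformity of
quantifier-free types, and satisfying a quantifier-free formula approximately depends only on
them. -/
def Close (F : Finset G) (δ : ℝ) (M : LGStructure.{u, v} G) (N : LGStructure.{u, w} G) {m : ℕ}
    (x : Fin m → M.carrier) (y : Fin m → N.carrier) : Prop :=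
  ∀ i j, ∀ g ∈ F, ‖M.ip (x i) (M.act g (x j)) - N.ip (y i) (N.act g (y j))‖ ≤ δ

variable [Group G]

theorem exists_close_of_isModel_sigmaGMinus {N : LGStructure.{u, w} G}
    (hN : IsModel N (sigmaGMinus G)) {m : ℕ} (x : Fin m → InftyRegularSpace G) (F : Finset G)
    {ε : ℝ} (hε : 0 < ε) : ∃ y : Fin m → N.carrier, Close F ε (inftyRegular G) N x y := by
  obtain ⟨y, hy⟩ := exists_dist_scalar_le_of_isModel_sigmaGMinus hN
    (fun p : Fin m × Fin m × F => .sinner (.vvar p.1) (.vact p.2.2 (.vvar p.2.1))) x hε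
  refine ⟨y, fun i j g hg => ?_⟩
  rw [← dist_eq_norm, dist_comm]
  exact (dist_pi_le_iff hε.le).1 hy (i, j, ⟨g, hg⟩)

variable {H : Type v} [NormedAddCommGroup H] [InnerProductSpace ℂ H] {K : Type w}
  [NormedAddCommGroup K] [InnerProductSpace ℂ K] [CompleteSpace K] {ρ : UnitaryRep G K}

theorem IsAmenable.exists_approx_orthogonal_copies (hG : IsAmenable G) (π : UnitaryRep G H)
    (e : H) (hρ : IsModel (ofRep ρ) (sigmaGMinus G)) (F : Finset G) (n : ℕ) {ε : ℝ}
    (hε : 0 < ε) :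
    ∃ d : Fin n → K, ∀ i j, ∀ g ∈ F,
      ‖inner ℂ (d i) (ρ g (d j)) - if i = j then inner ℂ e (π g e) else 0‖ ≤ ε := by
  obtain ⟨f, hf⟩ := hG.exists_orthogonal_copies π e F (half_pos hε)
  obtain ⟨d, hd⟩ := exists_close_of_isModel_sigmaGMinus hρ (fun i : Fin n => f i) F (half_pos hε)
  refine ⟨d, fun i j g hg => ?_⟩
  have close := hd i j g hg
  have orthogonal := hf i j g hg
  rw [norm_sub_rev] at close
  simp only [Fin.val_inj] at orthogonal
  exact (norm_sub_le_norm_sub_add_norm_sub _ _ _).trans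
    ((add_le_add close orthogonal).trans (add_halves ε).le)

theorem IsAmenable.exists_approx_copy (hG : IsAmenable G) (π : UnitaryRep G H) (e : H)
    (hρ : IsModel (ofRep ρ) (sigmaGMinus G)) (F : Finset G) {κ : Type*} [Finite κ] (b : κ → K)
    {ε : ℝ} (hε : 0 < ε) :
    ∃ e' : K, (∀ g ∈ F, ‖inner ℂ e (π g e) - inner ℂ e' (ρ g e')‖ ≤ ε) ∧
      ∀ k, ‖inner ℂ e' (b k)‖ ≤ ε := by
  classical
  cases nonempty_fintype κ
  let C : ℝ := ‖e‖ ^ 2 + 1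
  obtain ⟨n, hn⟩ := exists_nat_gt (C * ∑ k, ‖b k‖ ^ 2 / ε ^ 2)
  let δ : ℝ := min ε (1 / (n + 1))
  obtain ⟨d, hd⟩ := hG.exists_approx_orthogonal_copies π e hρ (insert 1 F) n (ε := δ)
    (lt_min hε (by positivity))
  have norm_inner_le (i j : Fin n) :
      ‖inner ℂ (d i) (d j)‖ ≤ (if i = j then ‖e‖ ^ 2 else 0) + 1 / (n + 1) := by
    have := hd i j 1 (Finset.mem_insert_self 1 F)
    simp only [map_one, LinearIsometryEquiv.coe_one, id_eq] at this
    have := (norm_sub_norm_le _ _).trans (this.trans (min_le_right _ _))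
    rw [apply_ite norm, norm_zero, ← inner_self_re_eq_norm, inner_self_eq_norm_sq] at this
    linarith
  have row_sum (i : Fin n) : ∑ j, ‖inner ℂ (d i) (d j)‖ ≤ C := by
    calc ∑ j, ‖inner ℂ (d i) (d j)‖
        ≤ ∑ j, ((if i = j then ‖e‖ ^ 2 else 0) + 1 / (n + 1)) :=
          Finset.sum_le_sum fun j _ => norm_inner_le i j
      _ = ‖e‖ ^ 2 + n * (1 / (n + 1)) := by simp [Finset.sum_add_distrib]
      _ ≤ ‖e‖ ^ 2 + 1 := by
          rw [mul_one_div]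
          gcongr
          exact div_le_one_of_le₀ (by linarith) (by positivity)
  obtain ⟨i, hi⟩ := exists_norm_inner_le_of_card (by positivity) row_sum b hε.le (by
    rwa [← Finset.sum_div, ← mul_div_assoc, div_lt_iff₀ (by positivity),
      ← Fintype.card_fin n] at hn)
  refine ⟨d i, fun g hg => ?_, hi⟩
  have := hd i i g (Finset.mem_insert_of_mem hg)
  rw [if_pos rfl, norm_sub_rev] at this
  exact this.trans (min_le_left _ _)

end ApproximateCopies

/-! ### Normal forms of terms -/

section NormalForms

variable {G : Type u} {m n : ℕ}

/-- The space of quantifier-free types of tuples of `m` vectors and `n` scalars: the coordinate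
`(i, j, g)` stands for `⟨xᵢ, τ_g xⱼ⟩` and the coordinate `j` for `zⱼ`. -/
abbrev TypeSpace (G : Type u) (m n : ℕ) : Type u := (Fin m × Fin m × G) ⊕ Fin n → ℂ

/-- The quantifier-free type of a tuple. -/
def qfType (M : LGStructure.{u, v} G) (x : Fin m → M.carrier) (z : Fin n → ℂ) :
    TypeSpace G m n :=
  Sum.elim (fun p => M.ip (x p.1) (M.act p.2.2 (x p.2.1))) z

/-- The coordinates of `TypeSpace` as continuous functions. -/
def TypeSpace.coord (i : (Fin m × Fin m × G) ⊕ Fin n) : C(TypeSpace G m n, ℂ) :=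
  ⟨fun τ => τ i, continuous_apply i⟩

/-- Normal forms of vector terms: linear combinations of translates `τ_g xᵢ` of the variables,
with coefficients depending continuously on the quantifier-free type. -/
abbrev VecForm (G : Type u) (m n : ℕ) : Type u := G × Fin m →₀ C(TypeSpace G m n, ℂ)

/-- The inner product of two linear combinations of translates in unitary representations, where
`⟨τ_g xᵢ, τ_h xⱼ⟩ = ⟨xᵢ, τ_{g⁻¹h} xⱼ⟩`. -/
def VecForm.pairing [Group G] (l l' : VecForm G m n) : C(TypeSpace G m n, ℂ) :=
  l'.sum fun p' c' => l.sum fun p c =>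
    c' * (star c * TypeSpace.coord (.inl (p.2, p'.2, p.1⁻¹ * p'.1)))

/-- Normal forms of terms. -/
abbrev NormalForm (G : Type u) (m n : ℕ) : Srt → Type u
  | .vec => VecForm G m n
  | .scal => C(TypeSpace G m n, ℂ)

variable [Group G]

/-- The normal form of a term, obtained by expanding it with the axioms of `T_G`. -/
def Term.normalForm : {s : Srt} → Term G m n s → NormalForm G m n s
  | _, .vvar i => Finsupp.single (1, i) 1
  | _, .vzero => (0 : VecForm G m n)
  | _, .vadd s t =>
      let l : VecForm G m n := s.normalForm
      let l' : VecForm G m n := t.normalForm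
      l + l'
  | _, .vsmul a s =>
      let c : C(TypeSpace G m n, ℂ) := a.normalForm
      let l : VecForm G m n := s.normalForm
      c • l
  | _, .vact g s =>
      let l : VecForm G m n := s.normalForm
      l.mapDomain (Prod.map (g * ·) id)
  | _, .svar j => TypeSpace.coord (.inr j)
  | _, .srat q => .const _ (q : ℂ)
  | _, .simag => .const _ Complex.I
  | _, .sadd a b =>
      let c : C(TypeSpace G m n, ℂ) := a.normalForm
      let d : C(TypeSpace G m n, ℂ) := b.normalForm
      c + d
  | _, .smul a b =>
      let c : C(TypeSpace G m n, ℂ) := a.normalForm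
      let d : C(TypeSpace G m n, ℂ) := b.normalForm
      c * d
  | _, .sconj a =>
      let c : C(TypeSpace G m n, ℂ) := a.normalForm
      star c
  | _, .sinner s t => VecForm.pairing s.normalForm t.normalForm
  | _, .snorm s =>
      ⟨fun τ => ((√(VecForm.pairing s.normalForm s.normalForm τ).re : ℝ) : ℂ), by fun_prop⟩

variable {H : Type v} [NormedAddCommGroup H] [InnerProductSpace ℂ H] (π : UnitaryRep G H)
  (x : Fin m → H)

/-- The value of a linear combination of translates at a tuple `x` and a type `τ`. -/
def VecForm.value (τ : TypeSpace G m n) (l : VecForm G m n) : H :=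
  l.sum fun p c => c τ • π p.1 (x p.2)

theorem VecForm.value_add (τ : TypeSpace G m n) (l l' : VecForm G m n) :
    (l + l').value π x τ = l.value π x τ + l'.value π x τ :=
  Finsupp.sum_add_index' (by simp) (by simp [add_smul])

theorem VecForm.value_smul (τ : TypeSpace G m n) (c : C(TypeSpace G m n, ℂ))
    (l : VecForm G m n) : (c • l).value π x τ = c τ • l.value π x τ := by
  rw [VecForm.value, Finsupp.sum_smul_index' (by simp), VecForm.value, Finsupp.smul_sum]
  simp [mul_smul]

theorem VecForm.value_mapDomain (τ : TypeSpace G m n) (g : G) (l : VecForm G m n) :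
    VecForm.value π x τ (l.mapDomain (Prod.map (g * ·) id)) = π g (l.value π x τ) := by
  rw [VecForm.value, Finsupp.sum_mapDomain_index (by simp) (by simp [add_smul]), VecForm.value,
    Finsupp.sum, Finsupp.sum, map_sum]
  simp

variable [CompleteSpace H] (z : Fin n → ℂ)

theorem VecForm.inner_value_value (l l' : VecForm G m n) :
    inner ℂ (l.value π x (qfType (ofRep π) x z)) (l'.value π x (qfType (ofRep π) x z)) =
      l.pairing l' (qfType (ofRep π) x z) := by
  have inner_act_act (g h : G) (a b : H) :
      inner ℂ (π g a) (π h b) = inner ℂ a (π (g⁻¹ * h) b) := by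
    rw [← (π g⁻¹).inner_map_map]
    simp
  simp only [VecForm.value, VecForm.pairing, Finsupp.sum, sum_inner, inner_sum, inner_smul_left,
    inner_smul_right, inner_act_act, ContinuousMap.sum_apply,
    Finset.mul_sum]
  rfl

/-- The value of a normal form, as an element of the interpretation of its sort. -/
def NormalForm.value (τ : TypeSpace G m n) : {s : Srt} → NormalForm G m n s → s.interp (ofRep π)
  | .vec, l => VecForm.value (H := H) π x τ l
  | .scal, c => ULift.up (c τ)

theorem Term.eval_eq_value_normalForm {s : Srt} (t : Term G m n s) :
    t.eval (ofRep π) x z = NormalForm.value π x (qfType (ofRep π) x z) t.normalForm := by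
  induction t with
  | vvar i =>
    have h : x i = VecForm.value π x (qfType (ofRep π) x z) (Finsupp.single (1, i) 1) := by
      simp [VecForm.value]
    exact h
  | vzero =>
    have h : 0 = VecForm.value π x (qfType (ofRep π) x z) 0 := by simp [VecForm.value]
    exact h
  | vadd s t hs ht =>
    exact (congrArg₂ (fun a b : H => a + b) hs ht).trans (VecForm.value_add ..).symm
  | vsmul a s ha hs =>
    exact (congrArg₂ (fun (c : ULift ℂ) (b : H) => c.down • b) ha hs).trans
      (VecForm.value_smul ..).symm
  | vact g s hs => exact (congrArg (π g) hs).trans (VecForm.value_mapDomain ..).symm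
  | svar j => rfl
  | srat q => rfl
  | simag => rfl
  | sadd a b ha hb => exact congrArg₂ (fun c d : ULift ℂ => ULift.up (c.down + d.down)) ha hb
  | smul a b ha hb => exact congrArg₂ (fun c d : ULift ℂ => ULift.up (c.down * d.down)) ha hb
  | sconj a ha => exact congrArg (fun c : ULift ℂ => ULift.up (star c.down)) ha
  | sinner s t hs ht =>
    exact (congrArg₂ (fun a b : H => ULift.up (inner ℂ a b)) hs ht).trans
      (congrArg ULift.up (VecForm.inner_value_value ..))
  | snorm s hs =>
    have norm_eq (a : H) : ((‖a‖ : ℝ) : ℂ) = ((√(inner ℂ a a).re : ℝ) : ℂ) :=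
      congrArg _ (norm_eq_sqrt_re_inner (𝕜 := ℂ) a)
    refine (congrArg (fun a : H => ULift.up ((‖a‖ : ℝ) : ℂ)) hs).trans (congrArg ULift.up ?_)
    exact (norm_eq _).trans
      (congrArg (fun c : ℂ => ((√c.re : ℝ) : ℂ)) (VecForm.inner_value_value ..))

theorem Term.scalar_eq_normalForm (t : Term G m n .scal) :
    t.scalar (ofRep π) x z = t.normalForm (qfType (ofRep π) x z) :=
  congrArg ULift.down (t.eval_eq_value_normalForm π x z)

theorem qfType_mem_pi_closedBall {R : ℝ} (h : ‖(x, z)‖ ≤ R) :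
    qfType (ofRep π) x z ∈ Set.univ.pi fun _ => Metric.closedBall (0 : ℂ) (max (R * R) R) := by
  obtain ⟨hx, hz⟩ := max_le_iff.1 h
  rintro (⟨i, j, g⟩ | j) - <;> rw [mem_closedBall_zero_iff, le_max_iff]
  · refine .inl ((norm_inner_le_norm (x i) (π g (x j))).trans ?_)
    rw [(π g).norm_map]
    exact mul_le_mul ((norm_le_pi_norm x i).trans hx) ((norm_le_pi_norm x j).trans hx)
      (norm_nonneg _) ((norm_nonneg x).trans hx)
  · exact .inr ((norm_le_pi_norm z j).trans hz)

end NormalForms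

/-! ### Uniform continuity of terms in the quantifier-free type -/

section UniformContinuity

theorem exists_finset_of_mem_uniformity_pi {ι X : Type*} [PseudoMetricSpace X]
    {U : Set ((ι → X) × (ι → X))} (hU : U ∈ uniformity (ι → X)) :
    ∃ (s : Finset ι) (δ : ℝ), 0 < δ ∧
      ∀ a b : ι → X, (∀ i ∈ s, dist (a i) (b i) ≤ δ) → (a, b) ∈ U := by
  classical
  rw [Pi.uniformity] at hU
  refine Filter.iInf_sets_induct hU ⟨∅, 1, one_pos, fun _ _ _ => trivial⟩ ?_
  rintro i U₁ U₂ ⟨V, hV, hVU⟩ ⟨s, δ, hδ, h⟩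
  obtain ⟨ε, hε, hεV⟩ := Metric.mem_uniformity_dist.1 hV
  obtain ⟨ε', hε', hεε⟩ := exists_between hε
  refine ⟨insert i s, min ε' δ, lt_min hε' hδ, fun a b hab => ⟨hVU (hεV ?_), h a b ?_⟩⟩
  · exact (hab i (s.mem_insert_self i)).trans_lt ((min_le_left _ _).trans_lt hεε)
  · exact fun j hj => (hab j (Finset.mem_insert_of_mem hj)).trans (min_le_right _ _)

theorem exists_finset_dist_le_of_isCompact {ι X Y : Type*} [PseudoMetricSpace X]
    [PseudoMetricSpace Y] {K : Set (ι → X)} (hK : IsCompact K) {f : (ι → X) → Y}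
    (hf : Continuous f) {ε : ℝ} (hε : 0 < ε) :
    ∃ (s : Finset ι) (δ : ℝ), 0 < δ ∧
      ∀ a ∈ K, ∀ b ∈ K, (∀ i ∈ s, dist (a i) (b i) ≤ δ) → dist (f a) (f b) ≤ ε := by
  have hunif := hK.uniformContinuousOn_of_continuous hf.continuousOn (Metric.dist_mem_uniformity hε)
  rw [Filter.mem_map, Filter.mem_inf_principal] at hunif
  obtain ⟨s, δ, hδ, hs⟩ := exists_finset_of_mem_uniformity_pi hunif
  exact ⟨s, δ, hδ, fun a ha b hb hab => le_of_lt (hs a b hab ⟨ha, hb⟩)⟩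

variable {G : Type u} {m n : ℕ}

/-- Tuples of vectors and scalars in two structures that are bounded by `R` and whose
quantifier-free types differ by at most `δ` at the scalars and at the matrix coefficients of
elements of `F`. -/
structure CloseWithin (F : Finset G) (δ R : ℝ) (M : LGStructure.{u, v} G)
    (N : LGStructure.{u, w} G) (x : Fin m → M.carrier) (y : Fin m → N.carrier)
    (z z' : Fin n → ℂ) : Prop where
  close : Close F δ M N x y
  dist_le : dist z z' ≤ δ
  norm_left_le : ‖(x, z)‖ ≤ R
  norm_right_le : ‖(y, z')‖ ≤ R

theorem Term.exists_dist_scalar_le_of_closeWithin [Group G] {ι : Type*} [Fintype ι]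
    (t : ι → Term G m n .scal) (R : ℝ) {ε : ℝ} (hε : 0 < ε) :
    ∃ (F : Finset G) (δ : ℝ), 0 < δ ∧
      ∀ (M : LGStructure.{u, v} G) (N : LGStructure.{u, w} G),
        IsModel M (theoryTG G) → IsModel N (theoryTG G) →
        ∀ (x : Fin m → M.carrier) (y : Fin m → N.carrier) (z z' : Fin n → ℂ),
          CloseWithin F δ R M N x y z z' →
            dist (fun i => (t i).scalar M x z) (fun i => (t i).scalar N y z') ≤ ε := by
  classical
  have normalForm_continuous : Continuous fun (τ : TypeSpace G m n) i => (t i).normalForm τ :=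
    continuous_pi fun i => ContinuousMap.continuous ((t i).normalForm : C(TypeSpace G m n, ℂ))
  obtain ⟨s, δ, hδ, hs⟩ := exists_finset_dist_le_of_isCompact
    (isCompact_univ_pi fun _ => isCompact_closedBall (0 : ℂ) (max (R * R) R))
    normalForm_continuous hε
  refine ⟨s.biUnion (Sum.elim (fun p => {p.2.2}) fun _ => ∅), δ, hδ,
    fun M N hM hN x y z z' h => ?_⟩
  obtain ⟨H, _, _, _, π, rfl⟩ := hM.exists_eq_ofRep
  obtain ⟨K, _, _, _, ρ, rfl⟩ := hN.exists_eq_ofRep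
  simp only [Term.scalar_eq_normalForm]
  refine hs _ (qfType_mem_pi_closedBall π x z h.norm_left_le) _
    (qfType_mem_pi_closedBall ρ y z' h.norm_right_le) ?_
  rintro (⟨i, j, g⟩ | j) hp
  · rw [dist_eq_norm]
    exact h.close i j g (Finset.mem_biUnion.2 ⟨_, hp, by simp⟩)
  · exact (dist_le_pi_dist z z' j).trans h.dist_le

end UniformContinuity

/-! ### Greedy approximation -/

section GreedySum

variable {E : Type v} [AddCommGroup E] [Module ℂ E] {ι : Type*} (d : ι → E → E) {N : ℕ}

/-- The last of the vectors `0 = v₀, v₁, …, v_N` with `vₖ₊₁ = vₖ + tₖ • d jₖ vₖ`, where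
`s k = (tₖ, jₖ)`. These are the approximations produced by a greedy algorithm that may move along
the directions `d j v` when it has reached the vector `v`. -/
def greedySum (s : Fin N → ℂ × ι) : E :=
  Fin.foldl N (fun v k => v + (s k).1 • d (s k).2 v) 0

theorem greedySum_snoc (s : Fin N → ℂ × ι) (p : ℂ × ι) :
    greedySum d (Fin.snoc s p : Fin (N + 1) → ℂ × ι) =
      greedySum d s + p.1 • d p.2 (greedySum d s) := by
  simp [greedySum, Fin.foldl_succ_last]

end GreedySum

section Greedy

variable {H : Type v} [NormedAddCommGroup H] [InnerProductSpace ℂ H]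

theorem exists_norm_sub_smul_sq_le {e v : H} {B ε : ℝ} (hB : 0 < B) (hε : 0 ≤ ε) (he : ‖e‖ ≤ B)
    (hv : ‖v‖ ≤ B) (h : ε ≤ ‖inner ℂ v e‖) :
    ∃ t : ℂ, ‖t‖ ≤ 1 ∧ ‖e - t • v‖ ^ 2 ≤ ‖e‖ ^ 2 - (ε / B) ^ 2 := by
  set a : ℝ := ‖inner ℂ v e‖
  have haB : a ≤ B ^ 2 := by
    refine (norm_inner_le_norm v e).trans ?_
    rw [sq]
    gcongr
  have norm_t : ‖(inner ℂ v e / (B : ℂ) ^ 2 : ℂ)‖ = a / B ^ 2 := by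
    rw [norm_div, norm_pow, Complex.norm_real, Real.norm_of_nonneg hB.le]
  refine ⟨inner ℂ v e / (B : ℂ) ^ 2, norm_t ▸ (div_le_one (by positivity)).2 haB, ?_⟩
  have re_inner : RCLike.re (inner ℂ e ((inner ℂ v e / (B : ℂ) ^ 2) • v)) = a ^ 2 / B ^ 2 := by
    rw [inner_smul_right, div_mul_eq_mul_div, ← inner_conj_symm e v, Complex.mul_conj']
    norm_cast
  calc ‖e - (inner ℂ v e / (B : ℂ) ^ 2) • v‖ ^ 2
      = ‖e‖ ^ 2 - 2 * (a ^ 2 / B ^ 2) + (a / B ^ 2 * ‖v‖) ^ 2 := by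
        rw [norm_sub_sq (𝕜 := ℂ), re_inner, norm_smul, norm_t]
    _ ≤ ‖e‖ ^ 2 - 2 * (a ^ 2 / B ^ 2) + (a / B ^ 2 * B) ^ 2 := by gcongr
    _ = ‖e‖ ^ 2 - (a / B) ^ 2 := by field_simp; ring
    _ ≤ ‖e‖ ^ 2 - (ε / B) ^ 2 := by gcongr

variable {ι : Type*} [Nonempty ι] (d : ι → H → H) (c : H) {B ε : ℝ}

theorem exists_greedySum_or (hB : 0 < B) (hε : 0 ≤ ε) (hc : ‖c‖ ≤ B)
    (hd : ∀ j v, ‖c - v‖ ≤ ‖c‖ → ‖d j v‖ ≤ B) (N : ℕ) :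
    ∃ s : Fin N → ℂ × ι, (∀ k, ‖(s k).1‖ ≤ 1) ∧ ‖c - greedySum d s‖ ≤ ‖c‖ ∧
      ((∀ j, ‖inner ℂ (d j (greedySum d s)) (c - greedySum d s)‖ ≤ ε) ∨
        ‖c - greedySum d s‖ ^ 2 ≤ ‖c‖ ^ 2 - N * (ε / B) ^ 2) := by
  induction N with
  | zero => exact ⟨Fin.elim0, fun k => k.elim0, by simp [greedySum]⟩
  | succ N ih =>
    obtain ⟨s, hs, hle, h⟩ := ih
    have norm_snoc_le {p : ℂ × ι} (hp : ‖p.1‖ ≤ 1) (k : Fin (N + 1)) :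
        ‖((Fin.snoc s p : Fin (N + 1) → ℂ × ι) k).1‖ ≤ 1 := by
      refine Fin.lastCases ?_ (fun k => ?_) k
      · simpa using hp
      · simpa using hs k
    by_cases horth : ∀ j, ‖inner ℂ (d j (greedySum d s)) (c - greedySum d s)‖ ≤ ε
    · refine ⟨Fin.snoc s (0, Classical.arbitrary ι), norm_snoc_le (by simp), ?_⟩
      rw [greedySum_snoc, zero_smul, add_zero]
      exact ⟨hle, .inl horth⟩
    · have hdecr := h.resolve_left horth
      push Not at horth
      obtain ⟨j, hj⟩ := horth
      obtain ⟨t, ht, hdecr'⟩ :=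
        exists_norm_sub_smul_sq_le hB hε (hle.trans hc) (hd j _ hle) hj.le
      refine ⟨Fin.snoc s (t, j), norm_snoc_le ht, ?_⟩
      rw [greedySum_snoc, ← sub_sub]
      refine ⟨?_, .inr ?_⟩
      · refine (pow_le_pow_iff_left₀ (norm_nonneg _) (norm_nonneg _) two_ne_zero).1 ?_ |>.trans hle
        exact hdecr'.trans (sub_le_self _ (sq_nonneg _))
      · push_cast
        linarith

theorem exists_greedySum_almost_orthogonal (hB : 0 < B) (hε : 0 < ε) (hc : ‖c‖ ≤ B)
    (hd : ∀ j v, ‖c - v‖ ≤ ‖c‖ → ‖d j v‖ ≤ B) {N : ℕ} (hN : B ^ 2 < N * (ε / B) ^ 2) :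
    ∃ s : Fin N → ℂ × ι, (∀ k, ‖(s k).1‖ ≤ 1) ∧
      ∀ j, ‖inner ℂ (d j (greedySum d s)) (c - greedySum d s)‖ ≤ ε := by
  obtain ⟨s, hs, -, horth | hdecr⟩ := exists_greedySum_or d c hB hε.le hc hd N
  · exact ⟨s, hs, horth⟩
  · have : ‖c‖ ^ 2 ≤ B ^ 2 := by gcongr
    nlinarith [sq_nonneg ‖c - greedySum d s‖]

end Greedy

section GreedyTerms

variable {G : Type u} {m N : ℕ} {E : Finset G}

/-- The term whose value is the `greedySum` along the directions `τ_g v`, `τ_g xᵢ` with `g ∈ E`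
that are prescribed by the word `w`, with the scalar variables as coefficients. -/
def greedyTerm (w : Fin N → E × Fin (m + 1)) : Term G m N .vec :=
  Fin.foldl N (fun t k => .vadd t (.vsmul (.svar k) (.vact (w k).1
    ((Matrix.vecCons t .vvar : Fin (m + 1) → Term G m N .vec) (w k).2)))) .vzero

/-- The directions for the `greedySum` of vectors near the span of the translates of `x`. -/
def translateDirection (M : LGStructure.{u, v} G) (x : Fin m → M.carrier)
    (j : E × Fin (m + 1)) (v : M.carrier) : M.carrier :=
  M.act j.1 ((Matrix.vecCons v x : Fin (m + 1) → M.carrier) j.2)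

variable (M : LGStructure.{u, v} G) (x : Fin m → M.carrier)

theorem vector_vecCons_vvar {n : ℕ} (z : Fin n → ℂ) (t : Term G m n .vec) (i : Fin (m + 1)) :
    ((Matrix.vecCons t .vvar : Fin (m + 1) → Term G m n .vec) i).vector M x z =
      (Matrix.vecCons (t.vector M x z) x : Fin (m + 1) → M.carrier) i :=
  Fin.cases rfl (fun _ => rfl) i

theorem vector_greedyTerm (s : Fin N → ℂ × E × Fin (m + 1)) :
    (greedyTerm fun k => (s k).2).vector M x (fun k => (s k).1) =
      greedySum (translateDirection M x) s := by
  simp only [greedyTerm, greedySum, Fin.foldl_eq_foldl_finRange]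
  refine (List.foldl_hom (fun t : Term G m N .vec => t.vector M x fun k => (s k).1)
    fun t k => ?_).symm
  simp only [Term.vector_vadd, Term.vector_vsmul, Term.vector_vact, Term.scalar_svar,
    vector_vecCons_vvar, translateDirection]

end GreedyTerms

theorem norm_inner_apply_comm {G : Type u} [Group G] {H : Type v} [NormedAddCommGroup H]
    [InnerProductSpace ℂ H] (π : UnitaryRep G H) (g : G) (x y : H) :
    ‖(inner ℂ x (π g y) : ℂ)‖ = ‖(inner ℂ y (π g⁻¹ x) : ℂ)‖ := by
  rw [norm_inner_symm, ← (π g⁻¹).inner_map_map, map_inv, LinearIsometryEquiv.coe_inv,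
    LinearIsometryEquiv.symm_apply_apply]

section Close

variable {G : Type u} {m : ℕ} {F F' : Finset G} {δ δ' ε : ℝ} {M : LGStructure.{u, v} G}
  {N : LGStructure.{u, w} G} {x : Fin m → M.carrier} {y : Fin m → N.carrier}

theorem Close.mono (h : Close F δ M N x y) (hF : F' ⊆ F) (hδ : δ ≤ δ') : Close F' δ' M N x y :=
  fun i j g hg => (h i j g (hF hg)).trans hδ

theorem Close.symm (h : Close F δ M N x y) : Close F δ N M y x := fun i j g hg => by
  rw [norm_sub_rev]
  exact h i j g hg

variable [Group G] {H : Type v} [NormedAddCommGroup H] [InnerProductSpace ℂ H] [CompleteSpace H]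
  {K : Type w} [NormedAddCommGroup K] [InnerProductSpace ℂ K] [CompleteSpace K]
  {π : UnitaryRep G H} {ρ : UnitaryRep G K}

theorem Close.abs_norm_sq_sub_le {x : Fin m → H} {y : Fin m → K}
    (h : Close F δ (ofRep π) (ofRep ρ) x y) (hF : 1 ∈ F) (i : Fin m) :
    |‖x i‖ ^ 2 - ‖y i‖ ^ 2| ≤ δ := by
  have := h i i 1 hF
  simp only [map_one, LinearIsometryEquiv.coe_one, id_eq, inner_self_eq_norm_sq_to_K] at this
  rw [← Real.norm_eq_abs, ← Complex.norm_real]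
  exact_mod_cast this

theorem Close.add {x u : Fin m → H} {y v : Fin m → K} (hxy : Close F ε (ofRep π) (ofRep ρ) x y)
    (huv : Close F ε (ofRep π) (ofRep ρ) u v) (hF : ∀ g ∈ F, g⁻¹ ∈ F)
    (hu : ∀ i j, ∀ g ∈ F, ‖(inner ℂ (u i) (π g (x j)) : ℂ)‖ ≤ ε)
    (hv : ∀ i j, ∀ g ∈ F, ‖(inner ℂ (v i) (ρ g (y j)) : ℂ)‖ ≤ ε) :
    Close F (6 * ε) (ofRep π) (ofRep ρ) (x + u) (y + v) := by
  intro i j g hg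
  have hu' : ‖(inner ℂ (x i) (π g (u j)) : ℂ)‖ ≤ ε :=
    (norm_inner_apply_comm π g _ _).trans_le (hu j i _ (hF g hg))
  have hv' : ‖(inner ℂ (y i) (ρ g (v j)) : ℂ)‖ ≤ ε :=
    (norm_inner_apply_comm ρ g _ _).trans_le (hv j i _ (hF g hg))
  have expand : inner ℂ (x i + u i) (π g (x j + u j)) - inner ℂ (y i + v i) (ρ g (y j + v j)) =
      (inner ℂ (x i) (π g (x j)) - inner ℂ (y i) (ρ g (y j))) +
      (inner ℂ (u i) (π g (u j)) - inner ℂ (v i) (ρ g (v j))) +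
      ((inner ℂ (x i) (π g (u j)) - inner ℂ (y i) (ρ g (v j))) +
      (inner ℂ (u i) (π g (x j)) - inner ℂ (v i) (ρ g (y j))) : ℂ) := by
    simp only [map_add, inner_add_left, inner_add_right]
    ring
  change ‖(inner ℂ (x i + u i) (π g (x j + u j)) - inner ℂ (y i + v i) (ρ g (y j + v j)) : ℂ)‖ ≤ _
  calc _ ≤ (ε + ε) + ((ε + ε) + (ε + ε)) := by
        rw [expand]
        refine norm_add_le_of_le (norm_add_le_of_le (hxy i j g hg) (huv i j g hg))
          (norm_add_le_of_le ?_ ?_)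
        · exact norm_sub_le_of_le hu' hv'
        · exact norm_sub_le_of_le (hu i j g hg) (hv i j g hg)
    _ = 6 * ε := by ring

end Close

section Extension

variable {G : Type u} [Group G] {m n : ℕ}

theorem Term.exists_close_of_closeWithin {ι : Type*} [Finite ι] {k : ℕ}
    (t : ι → Fin k → Term G m n .vec) (E : Finset G) (R : ℝ) {ε : ℝ} (hε : 0 < ε) :
    ∃ (F : Finset G) (δ : ℝ), 0 < δ ∧
      ∀ (M : LGStructure.{u, v} G) (N : LGStructure.{u, w} G),
        IsModel M (theoryTG G) → IsModel N (theoryTG G) →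
        ∀ (x : Fin m → M.carrier) (y : Fin m → N.carrier) (z z' : Fin n → ℂ),
          CloseWithin F δ R M N x y z z' →
            ∀ i, Close E ε M N (fun j => (t i j).vector M x z) fun j => (t i j).vector N y z' := by
  cases nonempty_fintype ι
  obtain ⟨F, δ, hδ, hF⟩ := Term.exists_dist_scalar_le_of_closeWithin.{u, v, w}
    (fun p : ι × Fin k × Fin k × E =>
      .sinner (t p.1 p.2.1) (.vact p.2.2.2 (t p.1 p.2.2.1))) R hε
  refine ⟨F, δ, hδ, fun M N hM hN x y z z' h i j j' g hg => ?_⟩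
  rw [← dist_eq_norm]
  exact (dist_pi_le_iff hε.le).1 (hF M N hM hN x y z z' h) (i, j, j', ⟨g, hg⟩)

variable {F : Finset G} {ε : ℝ} {H : Type v} [NormedAddCommGroup H] [InnerProductSpace ℂ H]
  [CompleteSpace H] {π : UnitaryRep G H}

theorem exists_greedyTerm_almost_orthogonal (hF : F.Nonempty) (r R : ℝ) (hε : 0 < ε) :
    ∃ k : ℕ, ∀ {H : Type v} [NormedAddCommGroup H] [InnerProductSpace ℂ H] [CompleteSpace H]
      (π : UnitaryRep G H) (x : Fin m → H) (c : H), ‖x‖ ≤ R → ‖c‖ ≤ r →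
      ∃ (w : Fin k → F × Fin (m + 1)) (z : Fin k → ℂ), ‖z‖ ≤ 1 ∧ ∀ i, ∀ g ∈ F,
        let v : H := (greedyTerm w).vector (ofRep π) x z
        ‖(inner ℂ (c - v) (π g ((Matrix.vecCons v x : Fin (m + 1) → H) i)) : ℂ)‖ ≤ ε := by
  have : Nonempty F := hF.to_subtype
  let B : ℝ := |R| + 2 * |r| + 1
  have hB : 0 < B := by positivity
  obtain ⟨k, hk⟩ := exists_nat_gt (B ^ 2 / (ε / B) ^ 2)
  rw [div_lt_iff₀ (by positivity)] at hk
  refine ⟨k, fun {H} _ _ _ π x c hx hc => ?_⟩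
  have hcB : ‖c‖ ≤ B := by linarith [le_abs_self r, abs_nonneg R, abs_nonneg r]
  have norm_direction_le (j : F × Fin (m + 1)) (v : H) (hv : ‖c - v‖ ≤ ‖c‖) :
      ‖translateDirection (ofRep π) x j v‖ ≤ B := by
    have norm_v_le : ‖v‖ ≤ B := by
      linarith [norm_sub_norm_le v c, norm_sub_rev c v, le_abs_self r, abs_nonneg R]
    have norm_x_le : ‖x‖ ≤ B := by linarith [le_abs_self R, abs_nonneg r]
    rw [translateDirection, LinearIsometryEquiv.norm_map]
    exact (norm_le_pi_norm _ _).trans ((norm_vecCons_le hB.le).2 ⟨norm_v_le, norm_x_le⟩)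
  obtain ⟨s, hs, horth⟩ :=
    exists_greedySum_almost_orthogonal _ c hB hε hcB norm_direction_le hk
  refine ⟨fun k => (s k).2, fun k => (s k).1, (pi_norm_le_iff_of_nonneg zero_le_one).2 hs,
    fun i g hg => ?_⟩
  simp only [vector_greedyTerm]
  exact (norm_inner_symm _ _).trans_le (horth (⟨g, hg⟩, i))

variable {K : Type w} [NormedAddCommGroup K] [InnerProductSpace ℂ K] [CompleteSpace K]
  {ρ : UnitaryRep G K}

theorem IsAmenable.exists_close_vecCons_add (hG : IsAmenable G)
    (hρ : IsModel (ofRep ρ) (sigmaGMinus G)) (hF : ∀ g ∈ F, g⁻¹ ∈ F) (hε : 0 < ε)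
    {x : Fin m → H} {y : Fin m → K} {e v : H} {u : K}
    (h : Close F ε (ofRep π) (ofRep ρ) (Matrix.vecCons v x) (Matrix.vecCons u y))
    (he : ∀ i, ∀ g ∈ F,
      ‖(inner ℂ e (π g ((Matrix.vecCons v x : Fin (m + 1) → H) i)) : ℂ)‖ ≤ ε) :
    ∃ d : K,
      Close F (6 * ε) (ofRep π) (ofRep ρ) (Matrix.vecCons (v + e) x) (Matrix.vecCons d y) := by
  obtain ⟨e', hee', he'⟩ := hG.exists_approx_copy π e hρ F
    (fun p : F × Fin (m + 1) => ρ p.1 ((Matrix.vecCons u y : Fin (m + 1) → K) p.2)) hε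
  refine ⟨u + e', ?_⟩
  have close_single : Close F ε (ofRep π) (ofRep ρ) (Matrix.vecCons e (0 : Fin m → H))
      (Matrix.vecCons e' (0 : Fin m → K)) := by
    intro i j g hg
    cases i using Fin.cases <;> cases j using Fin.cases <;> simp [hε.le, hee' g hg]
  convert h.add close_single hF (fun i j g hg => ?_) (fun i j g hg => ?_) using 1
  · rw [Matrix.cons_add_cons, add_zero]
  · rw [Matrix.cons_add_cons, add_zero]
  · cases i using Fin.cases
    · exact he j g hg
    · simpa using hε.le
  · cases i using Fin.cases
    · exact he' (⟨g, hg⟩, j)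
    · simpa using hε.le

theorem Close.norm_vecCons_le_of_sq_sub_sq {x : Fin m → H} {y : Fin m → K} {c : H} {d : K}
    {r r' : ℝ}
    (h : Close F (r' ^ 2 - r ^ 2) (ofRep π) (ofRep ρ) (Matrix.vecCons c x) (Matrix.vecCons d y))
    (hF : 1 ∈ F) (hc : ‖c‖ ≤ r) (hr' : 0 ≤ r') : ‖d‖ ≤ r' := by
  have norm_sq_sub_le := (abs_le.1 (h.abs_norm_sq_sub_le hF 0)).1
  simp only [Matrix.cons_val_zero] at norm_sq_sub_le
  have : ‖c‖ ^ 2 ≤ r ^ 2 := by gcongr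
  exact (pow_le_pow_iff_left₀ (norm_nonneg d) hr' two_ne_zero).1 (by linarith)

open scoped Pointwise in
theorem IsAmenable.exists_extension (hG : IsAmenable G) (F : Finset G) (R : ℝ) (hε : 0 < ε)
    {r r' : ℝ} (hr : 0 ≤ r) (hrr' : r < r') :
    ∃ (F' : Finset G) (δ : ℝ), 0 < δ ∧ ∀ (M : LGStructure.{u, v} G) (N : LGStructure.{u, w} G),
      IsModel M (theoryTG G) → IsModel N (theoryTG G ∪ sigmaGMinus G) →
      ∀ (x : Fin m → M.carrier) (y : Fin m → N.carrier), ‖x‖ ≤ R → ‖y‖ ≤ R →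
        Close F' δ M N x y → ∀ c, ‖c‖ ≤ r →
          ∃ d, ‖d‖ ≤ r' ∧ Close F ε M N (Matrix.vecCons c x) (Matrix.vecCons d y) := by
  classical
  let F₁ : Finset G := insert 1 (F ∪ F⁻¹)
  have inv_mem_F₁ (g : G) (hg : g ∈ F₁) : g⁻¹ ∈ F₁ := by
    simp only [F₁, Finset.mem_insert, Finset.mem_union, Finset.mem_inv', inv_inv,
      inv_eq_one] at hg ⊢
    tauto
  let ε₀ : ℝ := min ε (r' ^ 2 - r ^ 2)
  have hε₀ : 0 < ε₀ / 6 := by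
    have : 0 < r' ^ 2 - r ^ 2 := by nlinarith
    positivity
  obtain ⟨k, hk⟩ := exists_greedyTerm_almost_orthogonal.{u, v} (m := m) (F := F₁)
    (Finset.insert_nonempty _ _) r R hε₀
  obtain ⟨F', δ, hδ, hF'⟩ := Term.exists_close_of_closeWithin.{u, v, w}
    (fun w : Fin k → F₁ × Fin (m + 1) => Matrix.vecCons (greedyTerm w) .vvar) F₁ (max R 1) hε₀
  refine ⟨F', δ, hδ, fun M N hM hN x y hx hy hxy c hc => ?_⟩
  obtain ⟨H, _, _, _, π, rfl⟩ := hM.exists_eq_ofRep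
  obtain ⟨hNTG, hNsigma⟩ := isModel_union.1 hN
  obtain ⟨K, _, _, _, ρ, rfl⟩ := hNTG.exists_eq_ofRep
  obtain ⟨w, z, hz, horth⟩ := hk π x c hx hc
  have close_greedy := hF' _ _ hM hNTG x y z z
    ⟨hxy, by simpa using hδ.le, max_le_max hx hz, max_le_max hy hz⟩ w
  simp only [vector_vecCons_vvar] at close_greedy
  obtain ⟨d, hd⟩ := hG.exists_close_vecCons_add hNsigma inv_mem_F₁ hε₀ close_greedy horth
  rw [add_sub_cancel, mul_div_cancel₀ _ (by norm_num)] at hd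
  refine ⟨d, ?_, hd.mono (fun g hg => ?_) (min_le_left _ _)⟩
  · exact (hd.mono subset_rfl (min_le_right _ _)).norm_vecCons_le_of_sq_sub_sq
      (Finset.mem_insert_self 1 _) hc (hr.trans hrr'.le)
  · exact Finset.mem_insert_of_mem (Finset.mem_union_left _ hg)

end Extension

/-! ### Transfer of formulas between models -/

section NormVecCons

variable {E : Type v} {E' : Type w} [SeminormedAddCommGroup E] [SeminormedAddCommGroup E']
  {m : ℕ} {x : Fin m → E} {y : E'} {c : E} {R r : ℝ}

theorem norm_vecCons_prod_le (h : ‖(x, y)‖ ≤ R) (hc : ‖c‖ ≤ r) :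
    ‖(Matrix.vecCons c x, y)‖ ≤ max R r := by
  have hR : 0 ≤ max R r := (norm_nonneg c).trans (hc.trans (le_max_right _ _))
  rw [norm_prod_le_iff] at h ⊢
  exact ⟨(norm_vecCons_le hR).2 ⟨hc.trans (le_max_right _ _), h.1.trans (le_max_left _ _)⟩,
    h.2.trans (le_max_left _ _)⟩

theorem norm_prod_vecCons_le (h : ‖(y, x)‖ ≤ R) (hc : ‖c‖ ≤ r) :
    ‖(y, Matrix.vecCons c x)‖ ≤ max R r := by
  rw [Prod.norm_mk, max_comm, ← Prod.norm_mk] at h ⊢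
  exact norm_vecCons_prod_le h hc

end NormVecCons

section CloseWithin

variable {G : Type u} {m n : ℕ} {F F' : Finset G} {δ δ' R R' r : ℝ} {M : LGStructure.{u, v} G}
  {N : LGStructure.{u, w} G} {x : Fin m → M.carrier} {y : Fin m → N.carrier} {z z' : Fin n → ℂ}

theorem CloseWithin.mono (h : CloseWithin F δ R M N x y z z') (hF : F' ⊆ F) (hδ : δ ≤ δ') :
    CloseWithin F' δ' R M N x y z z' :=
  ⟨h.close.mono hF hδ, h.dist_le.trans hδ, h.norm_left_le, h.norm_right_le⟩

theorem CloseWithin.vecCons_vec (h : CloseWithin F δ R M N x y z z') {c : M.carrier}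
    {d : N.carrier} (hc : ‖c‖ ≤ r) (hd : ‖d‖ ≤ r) (hδ : δ ≤ δ')
    (hcd : Close F' δ' M N (Matrix.vecCons c x) (Matrix.vecCons d y)) :
    CloseWithin F' δ' (max R r) M N (Matrix.vecCons c x) (Matrix.vecCons d y) z z' :=
  ⟨hcd, h.dist_le.trans hδ, norm_vecCons_prod_le h.norm_left_le hc,
    norm_vecCons_prod_le h.norm_right_le hd⟩

theorem CloseWithin.vecCons_scalar (h : CloseWithin F δ R M N x y z z') {c : ℂ} (hc : ‖c‖ ≤ r) :
    CloseWithin F δ (max R r) M N x y (Matrix.vecCons c z) (Matrix.vecCons c z') := by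
  refine ⟨h.close, ?_, norm_prod_vecCons_le h.norm_left_le hc,
    norm_prod_vecCons_le h.norm_right_le hc⟩
  have hδ : 0 ≤ δ := dist_nonneg.trans h.dist_le
  rw [dist_pi_le_iff hδ, Fin.forall_fin_succ]
  exact ⟨by simpa using hδ, (dist_pi_le_iff hδ).1 h.dist_le⟩

end CloseWithin

section Transfers

variable {G : Type u} {m n : ℕ} {T : Theory G} {R : ℝ}

/-- Uniformly over all models of `T` and all tuples bounded by `R`, if a tuple satisfies `φ` then
every sufficiently close tuple satisfies `φ'`. -/
def Transfers (T : Theory G) (R : ℝ) (φ φ' : Formula G m n) : Prop :=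
  ∃ (F : Finset G) (δ : ℝ), 0 < δ ∧ ∀ (M : LGStructure.{u, v} G) (N : LGStructure.{u, w} G),
    IsModel M T → IsModel N T →
    ∀ (x : Fin m → M.carrier) (y : Fin m → N.carrier) (z z' : Fin n → ℂ),
      CloseWithin F δ R M N x y z z' → φ.Realize M x z → φ'.Realize N y z'

theorem Transfers.mono {T' : Theory G} {φ φ' : Formula G m n} (hT : T ⊆ T')
    (h : Transfers.{u, v, w} T R φ φ') : Transfers.{u, v, w} T' R φ φ' := by
  obtain ⟨F, δ, hδ, h⟩ := h
  exact ⟨F, δ, hδ, fun M N hM hN => h M N (hM.mono hT) (hN.mono hT)⟩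

theorem Transfers.exists_common {φ φ' ψ ψ' : Formula G m n} (hφ : Transfers.{u, v, w} T R φ φ')
    (hψ : Transfers.{u, v, w} T R ψ ψ') :
    ∃ (F : Finset G) (δ : ℝ), 0 < δ ∧ ∀ (M : LGStructure.{u, v} G) (N : LGStructure.{u, w} G),
      IsModel M T → IsModel N T →
      ∀ (x : Fin m → M.carrier) (y : Fin m → N.carrier) (z z' : Fin n → ℂ),
        CloseWithin F δ R M N x y z z' →
          (φ.Realize M x z → φ'.Realize N y z') ∧ (ψ.Realize M x z → ψ'.Realize N y z') := by
  classical
  obtain ⟨F, δ, hδ, h⟩ := hφ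
  obtain ⟨F', δ', hδ', h'⟩ := hψ
  exact ⟨F ∪ F', min δ δ', lt_min hδ hδ', fun M N hM hN x y z z' hxy =>
    ⟨h M N hM hN x y z z' (hxy.mono Finset.subset_union_left (min_le_left _ _)),
      h' M N hM hN x y z z' (hxy.mono Finset.subset_union_right (min_le_right _ _))⟩⟩

theorem Transfers.and {φ φ' ψ ψ' : Formula G m n} (hφ : Transfers.{u, v, w} T R φ φ')
    (hψ : Transfers.{u, v, w} T R ψ ψ') : Transfers.{u, v, w} T R (φ.and ψ) (φ'.and ψ') := by
  obtain ⟨F, δ, hδ, h⟩ := hφ.exists_common hψ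
  exact ⟨F, δ, hδ, fun M N hM hN x y z z' hxy =>
    And.imp (h M N hM hN x y z z' hxy).1 (h M N hM hN x y z z' hxy).2⟩

theorem Transfers.or {φ φ' ψ ψ' : Formula G m n} (hφ : Transfers.{u, v, w} T R φ φ')
    (hψ : Transfers.{u, v, w} T R ψ ψ') : Transfers.{u, v, w} T R (φ.or ψ) (φ'.or ψ') := by
  obtain ⟨F, δ, hδ, h⟩ := hφ.exists_common hψ
  exact ⟨F, δ, hδ, fun M N hM hN x y z z' hxy =>
    Or.imp (h M N hM hN x y z z' hxy).1 (h M N hM hN x y z z' hxy).2⟩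

theorem Transfers.exS {φ φ' : Formula G m (n + 1)} {r r' : PosRat} (hr : r ≤ r')
    (h : Transfers.{u, v, w} T (max R ((r' : ℚ) : ℝ)) φ φ') :
    Transfers.{u, v, w} T R (.exS r φ) (.exS r' φ') := by
  obtain ⟨F, δ, hδ, h⟩ := h
  refine ⟨F, δ, hδ, fun M N hM hN x y z z' hxy => ?_⟩
  rintro ⟨c, hc, hφ⟩
  have hc' : ‖c‖ ≤ ((r' : ℚ) : ℝ) := hc.trans (by exact_mod_cast hr)
  exact ⟨c, hc', h M N hM hN x y _ _ (hxy.vecCons_scalar hc') hφ⟩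

theorem Transfers.allS {φ φ' : Formula G m (n + 1)} {r r' : PosRat} (hr : r' ≤ r)
    (h : Transfers.{u, v, w} T (max R ((r : ℚ) : ℝ)) φ φ') :
    Transfers.{u, v, w} T R (.allS r φ) (.allS r' φ') := by
  obtain ⟨F, δ, hδ, h⟩ := h
  refine ⟨F, δ, hδ, fun M N hM hN x y z z' hxy hφ c hc => ?_⟩
  have hc' : ‖c‖ ≤ ((r : ℚ) : ℝ) := hc.trans (by exact_mod_cast hr)
  exact h M N hM hN x y _ _ (hxy.vecCons_scalar hc') (hφ c hc')

variable [Group G]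

theorem Term.exists_abs_re_sub_le_of_closeWithin (t : Term G m n .scal) (R : ℝ) {ε : ℝ}
    (hε : 0 < ε) :
    ∃ (F : Finset G) (δ : ℝ), 0 < δ ∧
      ∀ (M : LGStructure.{u, v} G) (N : LGStructure.{u, w} G),
        IsModel M (theoryTG G) → IsModel N (theoryTG G) →
        ∀ (x : Fin m → M.carrier) (y : Fin m → N.carrier) (z z' : Fin n → ℂ),
          CloseWithin F δ R M N x y z z' →
            |(t.scalar M x z).re - (t.scalar N y z').re| ≤ ε := by
  obtain ⟨F, δ, hδ, h⟩ :=
    Term.exists_dist_scalar_le_of_closeWithin.{u, v, w} (fun _ : Unit => t) R hε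
  refine ⟨F, δ, hδ, fun M N hM hN x y z z' hxy => ?_⟩
  rw [← Complex.sub_re]
  refine (Complex.abs_re_le_norm _).trans ?_
  rw [← dist_eq_norm]
  exact (dist_pi_le_iff hε.le).1 (h M N hM hN x y z z' hxy) ()

theorem transfers_le (hT : theoryTG G ⊆ T) (t : Term G m n .scal) {p p' : ℚ} (h : p < p') :
    Transfers.{u, v, w} T R (.le t p) (.le t p') := by
  have hε : (0 : ℝ) < p' - p := sub_pos.2 (by exact_mod_cast h)
  obtain ⟨F, δ, hδ, ht⟩ := t.exists_abs_re_sub_le_of_closeWithin.{u, v, w} R hε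
  refine ⟨F, δ, hδ, fun M N hM hN x y z z' hxy (hφ : _ ≤ (p : ℝ)) => ?_⟩
  have := abs_le.1 (ht M N (hM.mono hT) (hN.mono hT) x y z z' hxy)
  change _ ≤ (p' : ℝ)
  linarith

theorem transfers_ge (hT : theoryTG G ⊆ T) (t : Term G m n .scal) {p p' : ℚ} (h : p' < p) :
    Transfers.{u, v, w} T R (.ge t p) (.ge t p') := by
  have hε : (0 : ℝ) < p - p' := sub_pos.2 (by exact_mod_cast h)
  obtain ⟨F, δ, hδ, ht⟩ := t.exists_abs_re_sub_le_of_closeWithin.{u, v, w} R hε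
  refine ⟨F, δ, hδ, fun M N hM hN x y z z' hxy (hφ : (p : ℝ) ≤ _) => ?_⟩
  have := abs_le.1 (ht M N (hM.mono hT) (hN.mono hT) x y z z' hxy)
  change (p' : ℝ) ≤ _
  linarith

theorem IsAmenable.transfers_exV (hG : IsAmenable G) {φ φ' : Formula G (m + 1) n}
    {r r' : PosRat} (hr : r < r')
    (h : Transfers.{u, v, w} (theoryTG G ∪ sigmaGMinus G) (max R ((r' : ℚ) : ℝ)) φ φ') :
    Transfers.{u, v, w} (theoryTG G ∪ sigmaGMinus G) R (.exV r φ) (.exV r' φ') := by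
  have hrr' : ((r : ℚ) : ℝ) < ((r' : ℚ) : ℝ) := by exact_mod_cast hr
  obtain ⟨F, δ, hδ, h⟩ := h
  obtain ⟨F', δ', hδ', hext⟩ :=
    hG.exists_extension.{u, v, w} F R hδ (by exact_mod_cast r.2.le) hrr'
  refine ⟨F', min δ δ', lt_min hδ hδ', fun M N hM hN x y z z' hxy => ?_⟩
  rintro ⟨c, hc, hφ⟩
  obtain ⟨d, hd, hcd⟩ := hext M N (isModel_union.1 hM).1 hN x y
    (norm_prod_le_iff.1 hxy.norm_left_le).1 (norm_prod_le_iff.1 hxy.norm_right_le).1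
    (hxy.close.mono subset_rfl (min_le_right _ _)) c hc
  exact ⟨d, hd, h M N hM hN _ _ z z'
    (hxy.vecCons_vec (hc.trans hrr'.le) hd (min_le_left _ _) hcd) hφ⟩

theorem IsAmenable.transfers_allV (hG : IsAmenable G) {φ φ' : Formula G (m + 1) n}
    {r r' : PosRat} (hr : r' < r)
    (h : Transfers.{u, v, w} (theoryTG G ∪ sigmaGMinus G) (max R ((r : ℚ) : ℝ)) φ φ') :
    Transfers.{u, v, w} (theoryTG G ∪ sigmaGMinus G) R (.allV r φ) (.allV r' φ') := by
  have hrr' : ((r' : ℚ) : ℝ) < ((r : ℚ) : ℝ) := by exact_mod_cast hr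
  obtain ⟨F, δ, hδ, h⟩ := h
  obtain ⟨F', δ', hδ', hext⟩ :=
    hG.exists_extension.{u, w, v} F R hδ (by exact_mod_cast r'.2.le) hrr'
  refine ⟨F', min δ δ', lt_min hδ hδ', fun M N hM hN x y z z' hxy hφ d hd => ?_⟩
  obtain ⟨c, hc, hdc⟩ := hext N M (isModel_union.1 hN).1 hM y x
    (norm_prod_le_iff.1 hxy.norm_right_le).1 (norm_prod_le_iff.1 hxy.norm_left_le).1
    (hxy.close.symm.mono subset_rfl (min_le_right _ _)) d hd
  exact h M N hM hN _ _ z z'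
    (hxy.vecCons_vec hc (hd.trans hrr'.le) (min_le_left _ _) hdc.symm) (hφ c hc)

theorem IsAmenable.transfers (hG : IsAmenable G) {φ φ' : Formula G m n} (h : φ.Approx φ')
    (R : ℝ) : Transfers.{u, v, w} (theoryTG G ∪ sigmaGMinus G) R φ φ' := by
  induction h generalizing R with
  | le h => exact transfers_le Set.subset_union_left _ h
  | ge h => exact transfers_ge Set.subset_union_left _ h
  | and _ _ ih ih' => exact (ih R).and (ih' R)
  | or _ _ ih ih' => exact (ih R).or (ih' R)
  | exV hr _ ih => exact hG.transfers_exV hr (ih _)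
  | allV hr _ ih => exact hG.transfers_allV hr (ih _)
  | exS hr _ ih => exact (ih _).exS hr.le
  | allS hr _ ih => exact (ih _).allS hr.le

end Transfers

/-! ### Quantifier elimination -/

section QuantifierElimination

theorem exists_finset_dist_le_of_denseRange {α X : Type*} [PseudoMetricSpace X] {K : Set X}
    (hK : IsCompact K) {f : α → X} (hf : DenseRange f) {ε : ℝ} (hε : 0 < ε) :
    ∃ t : Finset α, ∀ x ∈ K, ∃ a ∈ t, dist x (f a) ≤ ε := by
  obtain ⟨t, ht⟩ := hK.elim_finite_subcover (fun a => Metric.ball (f a) ε)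
    (fun _ => Metric.isOpen_ball) fun x _ => Set.mem_iUnion.2 (hf.exists_dist_lt x hε)
  refine ⟨t, fun x hx => ?_⟩
  obtain ⟨a, ha, hxa⟩ := Set.mem_iUnion₂.1 (ht hx)
  exact ⟨a, ha, hxa.le⟩

variable {G : Type u} {m n : ℕ} {F : Finset G} {δ R : ℝ}

/-- Terms for the finitely many coordinates of the quantifier-free type that involve only elements
of `F`. -/
def coordTerm (F : Finset G) : (Fin m × Fin m × F) ⊕ Fin n → Term G m n .scal
  | .inl p => .sinner (.vvar p.1) (.vact p.2.2 (.vvar p.2.1))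
  | .inr j => .svar j

theorem closeWithin_of_realize_boxFormula {M : LGStructure.{u, v} G} {N : LGStructure.{u, w} G}
    {x : Fin m → M.carrier} {y : Fin m → N.carrier} {z z' : Fin n → ℂ} {ε ε' : ℚ}
    {q : (Fin m × Fin m × F) ⊕ Fin n → ℚ × ℚ} (hε : 0 ≤ ε) (hε' : 0 ≤ ε') (hδ : ε + ε' ≤ δ)
    (hx : ‖(x, z)‖ ≤ R) (hy : ‖(y, z')‖ ≤ R)
    (h : (boxFormula (coordTerm F) q ε).Realize M x z)
    (h' : (boxFormula (coordTerm F) q ε').Realize N y z') : CloseWithin F δ R M N x y z z' := by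
  rw [realize_boxFormula hε] at h
  rw [realize_boxFormula hε'] at h'
  have hdist := (dist_triangle_right _ _ _).trans ((add_le_add h h').trans hδ)
  have hδ : 0 ≤ δ := dist_nonneg.trans hdist
  rw [dist_pi_le_iff hδ] at hdist
  refine ⟨fun i j g hg => ?_, (dist_pi_le_iff hδ).2 fun j => hdist (.inr j), hx, hy⟩
  rw [← dist_eq_norm]
  exact hdist (.inl (i, j, ⟨g, hg⟩))

variable [Group G]

theorem exists_finset_realize_boxFormula (m n : ℕ) (F : Finset G) (R : ℝ) {ε : ℚ} (hε : 0 < ε) :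
    ∃ t : Finset ((Fin m × Fin m × F) ⊕ Fin n → ℚ × ℚ),
      ∀ M : LGStructure.{u, v} G, IsModel M (theoryTG G) →
        ∀ (x : Fin m → M.carrier) (z : Fin n → ℂ), ‖(x, z)‖ ≤ R →
          ∃ q ∈ t, (boxFormula (coordTerm F) q ε).Realize M x z := by
  obtain ⟨t, ht⟩ := exists_finset_dist_le_of_denseRange
    (isCompact_univ_pi fun _ : (Fin m × Fin m × F) ⊕ Fin n =>
      isCompact_closedBall (0 : ℂ) (max (R * R) R))
    (DenseRange.piMap fun _ => denseRange_ratComplex) (ε := ε) (by exact_mod_cast hε)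
  refine ⟨t, fun M hM x z hxz => ?_⟩
  obtain ⟨H, _, _, _, π, rfl⟩ := hM.exists_eq_ofRep
  have hmem := qfType_mem_pi_closedBall π x z hxz
  simp only [realize_boxFormula hε.le]
  refine ht _ ?_
  rintro (⟨i, j, g⟩ | j) -
  · exact hmem (.inl (i, j, g)) trivial
  · exact hmem (.inr j) trivial

variable {T : Theory G}

theorem hasQE_of_transfers (hT : theoryTG G ⊆ T)
    (h : ∀ {m n : ℕ} {φ φ' : Formula G m n}, φ.Approx φ' → ∀ R, Transfers.{u, v, v} T R φ φ') :
    HasQE.{u, v} T := by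
  classical
  intro m n φ φ' hφ R
  obtain ⟨F, δ, hδ, hF⟩ := h hφ ((R : ℚ) : ℝ)
  obtain ⟨ε, hε, hεδ⟩ : ∃ ε : ℚ, 0 < ε ∧ (ε + (2 * ε : ℚ) : ℝ) ≤ δ := by
    obtain ⟨ε, hε, hεδ⟩ := exists_rat_btwn (show 0 < δ / 3 by positivity)
    exact ⟨ε, by exact_mod_cast hε, by push_cast; linarith⟩
  obtain ⟨t, ht⟩ := exists_finset_realize_boxFormula.{u, v} m n F R hε
  have norm_le {E : Type v} [SeminormedAddCommGroup E] {x : Fin m → E} {z : Fin n → ℂ}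
      (hx : ∀ i, ‖x i‖ ≤ ((R : ℚ) : ℝ)) (hz : ∀ j, ‖z j‖ ≤ ((R : ℚ) : ℝ)) :
      ‖(x, z)‖ ≤ ((R : ℚ) : ℝ) := by
    have hR : (0 : ℝ) ≤ (R : ℚ) := by exact_mod_cast R.2.le
    exact max_le ((pi_norm_le_iff_of_nonneg hR).2 hx) ((pi_norm_le_iff_of_nonneg hR).2 hz)
  -- `ψ` is the disjunction of the boxes that contain a tuple satisfying `φ`.
  let s := t.filter fun q => ∃ M : LGStructure.{u, v} G, IsModel M T ∧
    ∃ x z, ‖(x, z)‖ ≤ ((R : ℚ) : ℝ) ∧ φ.Realize M x z ∧ (boxFormula (coordTerm F) q ε).Realize M x z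
  obtain ⟨ψ', hψψ', hψ'⟩ := exists_approx_disjunction.{u, v} s.toList fun q =>
    boxFormula_approx (coordTerm F) q hε.le (show ε < 2 * ε by linarith)
  refine ⟨_, ψ', disjunction_isQF fun χ hχ => ?_, hψψ', fun M hM x z hx hz =>
    ⟨fun hφx => ?_, fun hψ'x => ?_⟩⟩
  · obtain ⟨q, -, rfl⟩ := List.mem_map.1 hχ
    exact boxFormula_isQF _ _ _
  · have hxz := norm_le hx hz
    obtain ⟨q, hq, hbox⟩ := ht M (hM.mono hT) x z hxz
    have hqs : q ∈ s := Finset.mem_filter.2 ⟨hq, M, hM, x, z, hxz, hφx, hbox⟩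
    exact realize_disjunction.2 ⟨_, List.mem_map_of_mem (Finset.mem_toList.2 hqs), hbox⟩
  · obtain ⟨q, hqs, hbox⟩ := hψ' M x z hψ'x
    obtain ⟨-, N, hN, y, z', hyz', hφy, hbox'⟩ := Finset.mem_filter.1 (Finset.mem_toList.1 hqs)
    exact hF N M hN hM y x z' z (closeWithin_of_realize_boxFormula hε.le (by positivity) hεδ hyz'
      (norm_le hx hz) hbox' hbox) hφy

end QuantifierElimination

/-! ### Model completeness -/

section ModelCompleteness

variable {G : Type u} {m n : ℕ} {F : Finset G} {δ R : ℝ} {T : Theory G}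
  {M : LGStructure.{u, v} G} {N : LGStructure.{u, w} G} {x : Fin m → M.carrier}
  {y : Fin m → N.carrier} {z z' : Fin n → ℂ}

theorem CloseWithin.symm (h : CloseWithin F δ R M N x y z z') : CloseWithin F δ R N M y x z' z :=
  ⟨h.close.symm, dist_comm z z' ▸ h.dist_le, h.norm_right_le, h.norm_left_le⟩

theorem Embedding.closeWithin (f : Embedding M N) (F : Finset G) (hδ : 0 ≤ δ)
    (x : Fin m → M.carrier) (z : Fin n → ℂ) :
    CloseWithin F δ ‖(x, z)‖ M N x (fun i => f.toLinearIsometry (x i)) z z := by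
  refine ⟨fun i j g _ => ?_, by rwa [dist_self], le_rfl, ?_⟩
  · rwa [← f.map_act, f.map_ip, sub_self, norm_zero]
  · simp [Prod.norm_mk, Pi.norm_def]

theorem Formula.ApproxRealize.of_forall_closeWithin {φ : Formula G m n}
    (hT : ∀ {φ' φ'' : Formula G m n}, φ'.Approx φ'' → Transfers.{u, v, w} T R φ' φ'')
    (hM : IsModel M T) (hN : IsModel N T) (h : ∀ F δ, 0 < δ → CloseWithin F δ R M N x y z z')
    (hφ : φ.ApproxRealize M x z) : φ.ApproxRealize N y z' := by
  intro φ' hφφ'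
  obtain ⟨ψ, hφψ, hψφ'⟩ := hφφ'.exists_between
  obtain ⟨F, δ, hδ, hF⟩ := hT hψφ'
  exact hF M N hM hN x y z z' (h F δ hδ) (hφ ψ hφψ)

theorem isModelComplete_of_transfers
    (hT : ∀ {m n : ℕ} {φ φ' : Formula G m n}, φ.Approx φ' → ∀ R, Transfers.{u, v, v} T R φ φ') :
    IsModelComplete.{u, v} T := by
  intro M N hM hN f m n φ x z
  exact ⟨.of_forall_closeWithin (hT · _) hM hN fun F δ hδ => f.closeWithin F hδ.le x z,
    .of_forall_closeWithin (hT · _) hN hM fun F δ hδ => (f.closeWithin F hδ.le x z).symm⟩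

end ModelCompleteness

/-! ### Direct sums of unitary representations -/

section DirectSums

variable {G : Type u} [Group G] {H : Type v} [NormedAddCommGroup H] [InnerProductSpace ℂ H]
  {K : Type w} [NormedAddCommGroup K] [InnerProductSpace ℂ K]

/-- The direct sum of two unitary representations. -/
def prodRep (π : UnitaryRep G H) (ρ : UnitaryRep G K) : UnitaryRep G (WithLp 2 (H × K)) where
  toFun g := (π g).withLpProdCongr 2 (ρ g)
  map_one' := by rw [map_one, map_one]; rfl
  map_mul' g h := by rw [map_mul, map_mul]; rfl

variable (H K) in
/-- The inclusion of the first summand in a direct sum of Hilbert spaces. -/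
def inlIsometry : H →ₗᵢ[ℂ] WithLp 2 (H × K) where
  __ := (WithLp.linearEquiv 2 ℂ (H × K)).symm.toLinearMap ∘ₗ .inl ℂ H K
  norm_map' := WithLp.norm_toLp_fst 2 H K

variable (H K) in
/-- The inclusion of the second summand in a direct sum of Hilbert spaces. -/
def inrIsometry : K →ₗᵢ[ℂ] WithLp 2 (H × K) where
  __ := (WithLp.linearEquiv 2 ℂ (H × K)).symm.toLinearMap ∘ₗ .inr ℂ H K
  norm_map' := WithLp.norm_toLp_snd 2 H K

theorem inlIsometry_intertwines (π : UnitaryRep G H) (ρ : UnitaryRep G K) (g : G) (x : H) :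
    inlIsometry H K (π g x) = prodRep π ρ g (inlIsometry H K x) :=
  WithLp.ofLp_injective 2 (Prod.ext rfl (map_zero (ρ g)).symm)

theorem inrIsometry_intertwines (π : UnitaryRep G H) (ρ : UnitaryRep G K) (g : G) (y : K) :
    inrIsometry H K (ρ g y) = prodRep π ρ g (inrIsometry H K y) :=
  WithLp.ofLp_injective 2 (Prod.ext (map_zero (π g)).symm rfl)

end DirectSums

/-! ### The theory `T_GA` -/

section TheoryTGA

variable {G : Type u} [Group G]

theorem isModel_sigmaGMinus_inftyRegular : IsModel (inftyRegular G) (sigmaGMinus G) := by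
  rintro σ' ⟨σ, ⟨-, hσ⟩, hσσ'⟩
  exact Formula.Realize.approxRealize (hσσ'.realize hσ)

theorem IsModel.sigmaGMinus_of_embedding {M : LGStructure.{u, v} G}
    (f : Embedding (inftyRegular G) M) : IsModel M (sigmaGMinus G) := by
  rintro σ' ⟨σ, ⟨hσ, hreal⟩, hσσ'⟩
  have h := f.realize_of_isExistential hσ hreal
  rw [Subsingleton.elim (fun i => f.toLinearIsometry _) ![]] at h
  exact Formula.Realize.approxRealize (hσσ'.realize h)

variable (G) in
theorem theoryTG_union_sigmaGMinus_subset_theoryTGA :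
    theoryTG G ∪ sigmaGMinus G ⊆ theoryTGA G :=
  isModel_union.2 ⟨isModel_theoryTG_ofRep (inftyRegularRep G), isModel_sigmaGMinus_inftyRegular⟩

theorem IsAmenable.axiomatizes_theoryTGA (hG : IsAmenable G) :
    Axiomatizes.{u, v} (theoryTG G ∪ sigmaGMinus G) (theoryTGA G) := by
  refine fun M => ⟨fun hM => hM.mono (theoryTG_union_sigmaGMinus_subset_theoryTGA G),
    fun hM σ hσ => ?_⟩
  refine Formula.ApproxRealize.of_forall_closeWithin (R := 0) (hG.transfers · 0)
    (theoryTG_union_sigmaGMinus_subset_theoryTGA G) hM (fun F δ hδ => ?_) hσ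
  exact ⟨fun i => i.elim0, by simpa using hδ.le, by simp, by simp⟩

theorem IsAmenable.transfers_theoryTGA (hG : IsAmenable G) {m n : ℕ} {φ φ' : Formula G m n}
    (h : φ.Approx φ') (R : ℝ) : Transfers.{u, v, w} (theoryTGA G) R φ φ' :=
  (hG.transfers h R).mono (theoryTG_union_sigmaGMinus_subset_theoryTGA G)

theorem IsAmenable.hasQE_theoryTGA (hG : IsAmenable G) : HasQE.{u, v} (theoryTGA G) :=
  hasQE_of_transfers (Set.subset_union_left.trans (theoryTG_union_sigmaGMinus_subset_theoryTGA G))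
    hG.transfers_theoryTGA

theorem IsAmenable.exists_embedding_isModel_theoryTGA (hG : IsAmenable G)
    {M : LGStructure.{u, v} G} (hM : IsModel M (theoryTG G)) :
    ∃ N : LGStructure.{u, max u v} G, IsModel N (theoryTGA G) ∧ Nonempty (Embedding M N) := by
  obtain ⟨H, _, _, _, π, rfl⟩ := hM.exists_eq_ofRep
  have hinl := inlIsometry_intertwines π (inftyRegularRep G)
  have hinr := inrIsometry_intertwines π (inftyRegularRep G)
  exact ⟨ofRep (prodRep π (inftyRegularRep G)), (hG.axiomatizes_theoryTGA _).2 (isModel_union.2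
    ⟨isModel_theoryTG_ofRep _, .sigmaGMinus_of_embedding (.ofIntertwining _ hinr)⟩),
    ⟨.ofIntertwining _ hinl⟩⟩

theorem IsAmenable.isModelCompanion_theoryTGA (hG : IsAmenable G) :
    IsModelCompanion.{u, v} (theoryTGA G) (theoryTG G) := by
  refine ⟨isModelComplete_of_transfers hG.transfers_theoryTGA,
    fun M hM => hG.exists_embedding_isModel_theoryTGA hM, fun M hM => ?_⟩
  have hT : theoryTG G ⊆ theoryTGA G :=
    Set.subset_union_left.trans (theoryTG_union_sigmaGMinus_subset_theoryTGA G)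
  obtain ⟨N, hN, hf⟩ := hG.exists_embedding_isModel_theoryTGA (hM.mono hT)
  exact ⟨N, hN.mono hT, hf⟩

end TheoryTGA

end HilbRep

end

theorem mainTheorem3_general (G : Type u) [Group G] (hG : HilbRep.IsAmenable G) :
    HilbRep.HasQE.{u, v} (HilbRep.theoryTGA G) ∧
    HilbRep.Axiomatizes.{u, v} (HilbRep.theoryTG G ∪ HilbRep.sigmaGMinus G)
      (HilbRep.theoryTGA G) ∧
    HilbRep.IsModelCompanion.{u, v} (HilbRep.theoryTGA G) (HilbRep.theoryTG G) :=
  ⟨hG.hasQE_theoryTGA, hG.axiomatizes_theoryTGA, hG.isModelCompanion_theoryTGA⟩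

theorem mainTheorem3 (G : Type u) [Group G] [Countable G] (hG : HilbRep.IsAmenable G) :
    HilbRep.HasQE.{u, v} (HilbRep.theoryTGA G) ∧
    HilbRep.Axiomatizes.{u, v} (HilbRep.theoryTG G ∪ HilbRep.sigmaGMinus G)
      (HilbRep.theoryTGA G) ∧
    HilbRep.IsModelCompanion.{u, v} (HilbRep.theoryTGA G) (HilbRep.theoryTG G) :=
  mainTheorem3_general G hG
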